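/- Let $\alpha,\beta,\gamma,a,b,k,T,T_0,A',A''$ be positive real numbers such that $\alpha\neq 1$, $0<a\le\min\{1,T/(8\pi k)\}$, $b\ge T$, $k\ge 1$, $T\ge T_0\ge 1$, and such that $1\le k\le A''T$ or $k\ge A'T$. Put $$U(T,k)=\sqrt{\frac{T}{2\pi k}+\frac14},\qquad \eta(k)=U(1,k)-\frac12,$$ and let $\delta(T)=\log T$ if $\gamma-\alpha-\beta=-1$ and $\delta(T)=\dfrac{T^{1+\gamma-\alpha-\beta}-1}{1+\gamma-\alpha-\beta}$ otherwise. Define $$\mathcal U_1=2^{|\gamma-\beta|+1+\alpha+\beta-\gamma}3^{\gamma}\left(\frac{34.26(1+a)}{3-a}+\frac{39038}{|\alpha-1|}\right),\qquad \mathcal U_2=2.962\cdot 2^{|\gamma-\beta|+\alpha+\beta-\gamma}3^{\gamma},$$ $$\mathcal U_3=2^{|\gamma-\beta|+\alpha+\beta-\gamma}3^{\gamma}\left(1.02\,\delta(T)e^{-9.58\cdot10^{-6}\sqrt{Tk}}+\frac{212232.3}{k}\max\left\{b^{\gamma-\alpha-\beta},T^{\gamma-\alpha-\beta}\right\}e^{-4.79\cdot10^{-6}Tk}\right),$$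 $$\mathcal U_{41}=\frac{1.02\,(A'')^{5/4}\max\left\{1,(A'')^{\frac12(\gamma-\alpha-\beta)}\right\}}{|\alpha-1|}\,2^{|\gamma-\beta|}\bigl(38386.4(|\gamma-\alpha-\beta|+3)\bigr)^{\frac12|\gamma-\alpha-\beta|+\frac32},$$ $$\mathcal U_{42}=8.75\cdot10^{19}\left(1+\frac1{\eta(A'')}\right)^{|\gamma-\beta|}\left(\sqrt{A''}+\frac1{\sqrt{2\pi}}\right)^{3/2}\max\left\{(2\pi)^{-\frac12(\gamma-\alpha-\beta)},\left(\sqrt{A''}\,\eta(A'')\right)^{\gamma-\alpha-\beta}\right\},$$ $$\mathcal U_{43}=2^{|\gamma-\beta|}(A')^{-\alpha}\left(\frac{3.975\cdot10^{7}}{|\alpha-1|}A'+\frac{1.63\cdot10^{10}}{\sqrt{T_0}}\right),\qquad \mathcal U_{44}=3.5\cdot10^{19}\left(A'\eta(A')\right)^{-\alpha}\left(1+\frac1{2\pi A'}\right)^{|\gamma-\beta|+\frac32}.$$ Then $$\int_a^b y^{-\alpha}(1+y)^{-\beta}\left(\log\frac{1+y}{y}\right)^{-\gamma}\exp\left(i\left(T\log\frac{1+y}{y}+2\pi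 ky\right)\right)dy = M+\mathcal U,$$ where $$M=2^{-\frac12-\gamma}k^{-\frac34}\left(\frac{T}{2\pi}\right)^{\frac14}\left(1+\frac{k\pi}{2T}\right)^{-\frac14}\left(U(T,k)-\frac12\right)^{-\alpha}\left(U(T,k)+\frac12\right)^{-\beta}\left(\operatorname{arsinh}\sqrt{\frac{\pi k}{2T}}\right)^{-\gamma}\exp\left(i\left(2T\operatorname{arsinh}\sqrt{\frac{\pi k}{2T}}+\sqrt{(\pi k)^2+2\pi kT}-\pi k+\frac{\pi}{4}\right)\right)$$ and $$|\mathcal U|\le \mathcal U_1a^{1-\alpha}T^{-1}+\mathcal U_2b^{\gamma-\alpha-\beta}k^{-1}+\mathcal U_3+\mathcal U_4;$$ moreover $$\int_a^b y^{-\alpha}(1+y)^{-\beta}\left(\log\frac{1+y}{y}\right)^{-\gamma}\exp\left(i\left(T\log\frac{1+y}{y}-2\pi ky\right)\right)dy=\widehat{\mathcal U},\qquad |\widehat{\mathcal U}|\le \mathcal U_1a^{1-\alpha}T^{-1}+\mathcal U_2b^{\gamma-\alpha-\beta}k^{-1}+\mathcal U_3+\widehat{\mathcal U}_4.$$ Here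 one may take, if $1\le k\le A''T$, $$\mathcal U_4=2^{\alpha+\beta-\gamma}3^{\gamma}(\mathcal U_{41}+\mathcal U_{42})\,T^{\frac12(\gamma-\alpha-\beta)-\frac14}k^{-\frac12(\gamma-\alpha-\beta)-\frac54},\qquad \widehat{\mathcal U}_4=2^{\alpha+\beta-\gamma}3^{\gamma}\,\mathcal U_{41}\,T^{\frac12(\gamma-\alpha-\beta)-\frac14}k^{-\frac12(\gamma-\alpha-\beta)-\frac54},$$ and, if $k\ge A'T$, $$\mathcal U_4=2^{\alpha+\beta-\gamma}3^{\gamma}(\mathcal U_{43}+\mathcal U_{44})\,T^{-\frac12-\alpha}k^{\alpha-1},\qquad \widehat{\mathcal U}_4=2^{\alpha+\beta-\gamma}3^{\gamma}\,\mathcal U_{43}\,T^{-\frac12-\alpha}k^{\alpha-1}.$$ (If $k$ lies in both ranges, both bounds hold.) -/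

import Mathlib

namespace FirstIntegral

noncomputable section

open Real

/-- The integrand `y^(-α) (1+y)^(-β) (log((1+y)/y))^(-γ) exp(i (T log((1+y)/y) + 2πκy))`;
the two integrals of the theorem are those with `κ = k` and `κ = -k`. -/
def integrand (α β γ T κ y : ℝ) : ℂ :=
  ((y ^ (-α) * (1 + y) ^ (-β) * (log ((1 + y) / y)) ^ (-γ) : ℝ) : ℂ) *
    Complex.exp (Complex.I * ((T * log ((1 + y) / y) + 2 * π * κ * y : ℝ) : ℂ))

/-- `U(T,k) = √(T/(2πk) + 1/4)`. -/
def U (T k : ℝ) : ℝ := √(T / (2 * π * k) + 1 / 4)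

/-- `η(k) = U(1,k) - 1/2`. -/
def eta (k : ℝ) : ℝ := U 1 k - 1 / 2

open Classical in
/-- `δ(T)`, which depends also on `α, β, γ`. -/
def delta (α β γ T : ℝ) : ℝ :=
  if γ - α - β = -1 then log T
  else (T ^ (1 + γ - α - β) - 1) / (1 + γ - α - β)

/-- The main term of the integral with the sign `+`. -/
def mainTerm (α β γ k T : ℝ) : ℂ :=
  (((2 : ℝ) ^ (-(1 / 2) - γ) * k ^ (-(3 / 4) : ℝ) * (T / (2 * π)) ^ (1 / 4 : ℝ) *
      (1 + k * π / (2 * T)) ^ (-(1 / 4) : ℝ) *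
      (U T k - 1 / 2) ^ (-α) * (U T k + 1 / 2) ^ (-β) *
      (arsinh √(π * k / (2 * T))) ^ (-γ) : ℝ) : ℂ) *
    Complex.exp (Complex.I *
      ((2 * T * arsinh √(π * k / (2 * T)) + √((π * k) ^ 2 + 2 * π * k * T)
        - π * k + π / 4 : ℝ) : ℂ))

def U1 (α β γ a : ℝ) : ℝ :=
  (2 : ℝ) ^ (|γ - β| + 1 + α + β - γ) * (3 : ℝ) ^ γ *
    (34.26 * (1 + a) / (3 - a) + 39038 / |α - 1|)

def U2 (α β γ : ℝ) : ℝ :=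
  2.962 * (2 : ℝ) ^ (|γ - β| + α + β - γ) * (3 : ℝ) ^ γ

def U3 (α β γ b k T : ℝ) : ℝ :=
  (2 : ℝ) ^ (|γ - β| + α + β - γ) * (3 : ℝ) ^ γ *
    (1.02 * delta α β γ T * exp (-(9.58 / 10 ^ 6 * √(T * k))) +
      212232.3 / k * max (b ^ (γ - α - β)) (T ^ (γ - α - β)) *
        exp (-(4.79 / 10 ^ 6 * (T * k))))

def U41 (α β γ A'' : ℝ) : ℝ :=
  1.02 * A'' ^ (5 / 4 : ℝ) * max 1 (A'' ^ (1 / 2 * (γ - α - β))) / |α - 1| *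
    (2 : ℝ) ^ |γ - β| *
    (38386.4 * (|γ - α - β| + 3)) ^ (1 / 2 * |γ - α - β| + 3 / 2)

def U42 (α β γ A'' : ℝ) : ℝ :=
  8.75 * 10 ^ 19 * (1 + 1 / eta A'') ^ |γ - β| *
    (√A'' + 1 / √(2 * π)) ^ (3 / 2 : ℝ) *
    max ((2 * π) ^ (-(1 / 2) * (γ - α - β))) ((√A'' * eta A'') ^ (γ - α - β))

def U43 (α β γ A' T₀ : ℝ) : ℝ :=
  (2 : ℝ) ^ |γ - β| * A' ^ (-α) *
    (3.975 * 10 ^ 7 / |α - 1| * A' + 1.63 * 10 ^ 10 / √T₀)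

def U44 (α β γ A' : ℝ) : ℝ :=
  3.5 * 10 ^ 19 * (A' * eta A') ^ (-α) *
    (1 + 1 / (2 * π * A')) ^ (|γ - β| + 3 / 2)

/-- `𝒰₄` in the regime `1 ≤ k ≤ A'' T`. -/
def U4small (α β γ A'' k T : ℝ) : ℝ :=
  (2 : ℝ) ^ (α + β - γ) * (3 : ℝ) ^ γ * (U41 α β γ A'' + U42 α β γ A'') *
    T ^ (1 / 2 * (γ - α - β) - 1 / 4) * k ^ (-(1 / 2) * (γ - α - β) - 5 / 4)

/-- `𝒰₄` in the regime `k ≥ A' T`. -/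
def U4large (α β γ A' T₀ k T : ℝ) : ℝ :=
  (2 : ℝ) ^ (α + β - γ) * (3 : ℝ) ^ γ * (U43 α β γ A' T₀ + U44 α β γ A') *
    T ^ (-(1 / 2) - α) * k ^ (α - 1)

/-- `𝒰̂₄` in the regime `1 ≤ k ≤ A'' T`. -/
def U4hatSmall (α β γ A'' k T : ℝ) : ℝ :=
  (2 : ℝ) ^ (α + β - γ) * (3 : ℝ) ^ γ * U41 α β γ A'' *
    T ^ (1 / 2 * (γ - α - β) - 1 / 4) * k ^ (-(1 / 2) * (γ - α - β) - 5 / 4)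

/-- `𝒰̂₄` in the regime `k ≥ A' T`. -/
def U4hatLarge (α β γ A' T₀ k T : ℝ) : ℝ :=
  (2 : ℝ) ^ (α + β - γ) * (3 : ℝ) ^ γ * U43 α β γ A' T₀ *
    T ^ (-(1 / 2) - α) * k ^ (α - 1)

/-- The part `𝒰₁ a^(1-α) T⁻¹ + 𝒰₂ b^(γ-α-β) k⁻¹ + 𝒰₃` common to all the error bounds. -/
def commonError (α β γ a b k T : ℝ) : ℝ :=
  U1 α β γ a * a ^ (1 - α) * T⁻¹ + U2 α β γ * b ^ (γ - α - β) * k⁻¹ + U3 α β γ b k T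

end

end FirstIntegral

/-! The integrand extends holomorphically to `Re z > 0`, with modulus the amplitude times `exp (-Im
phase)`. Cauchy's theorem therefore lets the path leave the real axis on the side where the phase
has positive imaginary part. On the axis the phase has derivative `2πκ - T/(y(1+y))`. For `κ = -k`
this is negative throughout, so the whole path runs below the axis and everything is error. For `κ =
k` it vanishes only at the saddle point `w = U(T,k) - 1/2`, where `2πk w(1+w) = T`: the path stays
below the axis to the left of `w`, crosses it at `w` in the direction `1 + i`, and stays above it
afterwards.

The vertical side at `a` decays at rate `T/(5a)` and is paid by `U1`; the one at `b` decays at rate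
`5k` and is paid by `U2`. On the slanted rays the integrand is at most a constant times `majorant`,
whose exponent is `-(T/(1+y) + ky)/200`. On `[1,T]` and `[T,b]` this gives exponential decay in
`√(Tk)` and in `Tk`, hence `U3`. On `[a,1]` it gives `exp(-T/400)`, which beats every power of `T`;
that part is paid by `U1` if `α > 1`, by `U41` or `U43` if `α < 1`.

At the saddle (`norm_saddle_segment_le`) the large parameter is `Λ = T/(1+w)`: the phase has second
derivative at least `Λ/w²`, and in the variable `r = |ζ|/w` its Taylor remainders are of size `Λr³`
and `Λr⁴`. The Gaussian integral is exactly `mainTerm` (`mainTerm_eq`). The first corrections are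
odd and vanish, leaving a relative error of order `1/Λ`, which becomes `U42` or `U44` once `w =
η(k/T)` is bounded.

The common factor `2^(α+β-γ) 3^γ = 2^(α+β) (3/2)^γ` has two origins: `(3/2)^γ` from the lower bound
for the complex logarithm, `2^(α+β)` from the disc of radius `w/2` about the saddle. Most of the
stated numerical constants leave ample room for this contour. -/

namespace FirstIntegral

open Set Metric

/-! ### Holomorphic extension; bounds for amplitude and logarithm -/

/-- The holomorphic branch of `log ((1 + z) / z)` on the right half-plane. -/
noncomputable def logRatio (z : ℂ) : ℂ := Complex.log (1 + z) - Complex.log z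

/-- The holomorphic extension of the amplitude `y^(-α) (1+y)^(-β) (log((1+y)/y))^(-γ)`. -/
noncomputable def amplitude (α β γ : ℝ) (z : ℂ) : ℂ :=
  z ^ ((-α : ℝ) : ℂ) * (1 + z) ^ ((-β : ℝ) : ℂ) * logRatio z ^ ((-γ : ℝ) : ℂ)

/-- The holomorphic extension of the phase `T log((1+y)/y) + 2πκy`. -/
noncomputable def phase (T κ : ℝ) (z : ℂ) : ℂ := T * logRatio z + (2 * Real.pi * κ : ℝ) * z

/-- The holomorphic extension of `integrand` to the right half-plane. -/
noncomputable def holIntegrand (α β γ T κ : ℝ) (z : ℂ) : ℂ :=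
  amplitude α β γ z * Complex.exp (Complex.I * phase T κ z)

lemma ne_zero_of_re_pos {z : ℂ} (hz : 0 < z.re) : z ≠ 0 := by
  rintro rfl; simp at hz

lemma one_add_re_pos {z : ℂ} (hz : 0 < z.re) : 0 < (1 + z).re := by
  simp; linarith

/-- The real part is half of `log(1+t)` with `t = (2 Re z + 1)/|z|²`, and `log(1+t) ≥ 2t/(t+2)`. -/
lemma logRatio_re_ge {z : ℂ} (hz : 0 < z.re) :
    (2 * z.re + 1) / (2 * Complex.normSq z + 2 * z.re + 1) ≤ (logRatio z).re := by
  have h0 : 0 < Complex.normSq z := Complex.normSq_pos.mpr (ne_zero_of_re_pos hz)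
  have h1 : 0 < Complex.normSq (1 + z) :=
    Complex.normSq_pos.mpr (ne_zero_of_re_pos (one_add_re_pos hz))
  have hn : Complex.normSq (1 + z) = Complex.normSq z + 2 * z.re + 1 := by
    simp [Complex.normSq_apply]; ring
  have e1 : ∀ u : ℂ, u ≠ 0 → (Complex.log u).re = 1 / 2 * Real.log (Complex.normSq u) := by
    intro u hu
    rw [Complex.log_re, Complex.normSq_eq_norm_sq, Real.log_pow]; push_cast; ring
  have e2 : (logRatio z).re = 1 / 2 * Real.log (1 + (2 * z.re + 1) / Complex.normSq z) := by
    rw [logRatio, Complex.sub_re, e1 _ (ne_zero_of_re_pos hz),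
      e1 _ (ne_zero_of_re_pos (one_add_re_pos hz)), ← mul_sub, ← Real.log_div h1.ne' h0.ne', hn]
    congr 2; field_simp; ring
  have h := Real.le_log_one_add_of_nonneg (x := (2 * z.re + 1) / Complex.normSq z) (by positivity)
  rw [e2]
  refine le_trans (le_of_eq ?_) (mul_le_mul_of_nonneg_left h (by norm_num : (0:ℝ) ≤ 1 / 2))
  field_simp
  ring

lemma logRatio_re_pos {z : ℂ} (hz : 0 < z.re) : 0 < (logRatio z).re := by
  refine lt_of_lt_of_le ?_ (logRatio_re_ge hz)
  have := Complex.normSq_nonneg z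
  positivity

lemma hasDerivAt_logRatio {z : ℂ} (hz : 0 < z.re) :
    HasDerivAt logRatio ((1 + z)⁻¹ - z⁻¹) z := by
  have h1 : HasDerivAt (fun z : ℂ => Complex.log (1 + z)) (1 + z)⁻¹ z := by
    simpa using ((hasDerivAt_id' z).const_add 1).clog (Or.inl (one_add_re_pos hz))
  exact h1.sub (Complex.hasDerivAt_log (Or.inl hz))

lemma hasDerivAt_phase (T κ : ℝ) {z : ℂ} (hz : 0 < z.re) :
    HasDerivAt (phase T κ) (T * ((1 + z)⁻¹ - z⁻¹) + (2 * Real.pi * κ : ℝ)) z := by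
  have := ((hasDerivAt_logRatio hz).const_mul (T : ℂ)).add
    ((hasDerivAt_id' z).const_mul ((2 * Real.pi * κ : ℝ) : ℂ))
  rw [mul_one] at this
  exact this

lemma differentiableOn_amplitude (α β γ : ℝ) :
    DifferentiableOn ℂ (amplitude α β γ) {z | 0 < z.re} := by
  intro z hz
  have h1 : DifferentiableAt ℂ (fun z : ℂ => z ^ ((-α : ℝ) : ℂ)) z :=
    differentiableAt_id.cpow (differentiableAt_const _) (Or.inl hz)
  have h2 : DifferentiableAt ℂ (fun z : ℂ => (1 + z) ^ ((-β : ℝ) : ℂ)) z :=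
    (differentiableAt_id.const_add 1).cpow (differentiableAt_const _)
      (Or.inl (one_add_re_pos hz))
  have h3 : DifferentiableAt ℂ (fun z : ℂ => logRatio z ^ ((-γ : ℝ) : ℂ)) z :=
    (hasDerivAt_logRatio hz).differentiableAt.cpow (differentiableAt_const _)
      (Or.inl (logRatio_re_pos hz))
  exact ((h1.mul h2).mul h3).differentiableWithinAt

lemma differentiableOn_holIntegrand (α β γ T κ : ℝ) :
    DifferentiableOn ℂ (holIntegrand α β γ T κ) {z | 0 < z.re} := by
  refine (differentiableOn_amplitude α β γ).mul ?_
  intro z hz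
  exact ((hasDerivAt_phase T κ hz).differentiableAt.const_mul Complex.I).cexp.differentiableWithinAt

lemma logRatio_ofReal {y : ℝ} (hy : 0 < y) :
    logRatio (y : ℂ) = ((Real.log ((1 + y) / y) : ℝ) : ℂ) := by
  rw [logRatio, Real.log_div (by positivity) hy.ne', Complex.ofReal_sub,
    Complex.ofReal_log (by positivity), Complex.ofReal_log hy.le]
  push_cast; rfl

lemma log_ratio_pos {y : ℝ} (hy : 0 < y) : 0 < Real.log ((1 + y) / y) :=
  Real.log_pos (by rw [lt_div_iff₀ hy]; linarith)

lemma amplitude_ofReal (α β γ : ℝ) {y : ℝ} (hy : 0 < y) :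
    amplitude α β γ (y : ℂ) =
      ((y ^ (-α) * (1 + y) ^ (-β) * (Real.log ((1 + y) / y)) ^ (-γ) : ℝ) : ℂ) := by
  rw [amplitude, logRatio_ofReal hy, Complex.ofReal_mul, Complex.ofReal_mul,
    Complex.ofReal_cpow hy.le, Complex.ofReal_cpow (by positivity : 0 ≤ 1 + y),
    Complex.ofReal_cpow (log_ratio_pos hy).le]
  push_cast; rfl

lemma holIntegrand_ofReal (α β γ T κ : ℝ) {y : ℝ} (hy : 0 < y) :
    holIntegrand α β γ T κ (y : ℂ) = integrand α β γ T κ y := by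
  rw [holIntegrand, integrand, amplitude_ofReal α β γ hy, phase, logRatio_ofReal hy]
  push_cast; rfl

lemma norm_holIntegrand (α β γ T κ : ℝ) (z : ℂ) :
    ‖holIntegrand α β γ T κ z‖ = ‖amplitude α β γ z‖ *
      Real.exp (-(T * (logRatio z).im + 2 * Real.pi * κ * z.im)) := by
  rw [holIntegrand, norm_mul, Complex.norm_exp]
  congr 2
  rw [Complex.I_mul_re, phase, Complex.add_im, Complex.im_ofReal_mul, Complex.im_ofReal_mul]

/-- Bound for the amplitude where `|z|² ≤ (3/2) v Re z`. -/
lemma norm_amplitude_le {α β γ : ℝ} (hα : 0 < α) (hβ : 0 < β) (hγ : 0 < γ) {z : ℂ} {p q v : ℝ}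
    (hz : 0 < z.re) (hv : 0 < v) (hp : 0 < p) (hq : 0 < q)
    (h : Complex.normSq z ≤ 3 / 2 * v * z.re) (h1 : p ≤ ‖z‖) (h2 : q ≤ ‖1 + z‖) :
    ‖amplitude α β γ z‖ ≤ (3 / 2) ^ γ * (p ^ (-α) * q ^ (-β) * (1 + v) ^ γ) := by
  -- Source of `(3/2)^γ` in the error terms: `2|z|² ≤ 3v Re z` is inserted in `logRatio_re_ge`.
  have hL : (3 / 2 * (1 + v))⁻¹ ≤ ‖logRatio z‖ := by
    refine le_trans ?_ ((logRatio_re_ge hz).trans (Complex.re_le_norm _))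
    have := Complex.normSq_nonneg z
    rw [inv_eq_one_div, div_le_div_iff₀ (by positivity) (by positivity)]
    nlinarith
  rw [amplitude, norm_mul, norm_mul, Complex.norm_cpow_real, Complex.norm_cpow_real,
    Complex.norm_cpow_real]
  have k1 : ‖z‖ ^ (-α) ≤ p ^ (-α) := Real.rpow_le_rpow_of_nonpos hp h1 (by linarith)
  have k2 : ‖1 + z‖ ^ (-β) ≤ q ^ (-β) := Real.rpow_le_rpow_of_nonpos hq h2 (by linarith)
  have k3 : ‖logRatio z‖ ^ (-γ) ≤ (3 / 2) ^ γ * (1 + v) ^ γ := by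
    refine (Real.rpow_le_rpow_of_nonpos (by positivity) hL (by linarith)).trans (le_of_eq ?_)
    rw [Real.rpow_neg (by positivity), Real.inv_rpow (by positivity), inv_inv,
      Real.mul_rpow (by norm_num) (by positivity)]
  calc ‖z‖ ^ (-α) * ‖1 + z‖ ^ (-β) * ‖logRatio z‖ ^ (-γ)
      ≤ p ^ (-α) * q ^ (-β) * ((3 / 2) ^ γ * (1 + v) ^ γ) := by gcongr
    _ = _ := by ring

/-- Bound for the amplitude in the sector `|Im z| ≤ Re z / √2`. -/
lemma norm_amplitude_le_of_sector {α β γ : ℝ} (hα : 0 < α) (hβ : 0 < β) (hγ : 0 < γ) {z : ℂ}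
    {x : ℝ} (hx : 0 < x) (hzx : z.re = x) (h : 2 * z.im ^ 2 ≤ x ^ 2) :
    ‖amplitude α β γ z‖ ≤ (3 / 2) ^ γ * (x ^ (-α) * (1 + x) ^ (γ - β)) := by
  subst hzx
  refine (norm_amplitude_le hα hβ hγ hx hx hx (one_add_re_pos hx) ?_ (Complex.re_le_norm z)
    (Complex.re_le_norm _)).trans (le_of_eq ?_)
  · rw [Complex.normSq_apply]; nlinarith
  · have : (1 + z).re = 1 + z.re := by simp
    rw [this, mul_assoc (z.re ^ (-α)), ← Real.rpow_add (by positivity)]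
    congr 3; ring

/-- Bound for the amplitude on the disc with centre `w` and radius `w / 2`. -/
lemma norm_amplitude_le_of_disc {α β γ : ℝ} (hα : 0 < α) (hβ : 0 < β) (hγ : 0 < γ) {z : ℂ}
    {w : ℝ} (hw : 0 < w) (h : ‖z - w‖ ≤ w / 2) :
    ‖amplitude α β γ z‖ ≤ 2 ^ (α + β) * (3 / 2) ^ γ * (w ^ (-α) * (1 + w) ^ (γ - β)) := by
  have hsq : (z.re - w) ^ 2 + z.im ^ 2 ≤ w ^ 2 / 4 := by
    have := Complex.normSq_eq_norm_sq (z - w)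
    have h2 : ‖z - w‖ ^ 2 ≤ (w / 2) ^ 2 := pow_le_pow_left₀ (norm_nonneg _) h 2
    rw [← this, Complex.normSq_apply] at h2
    simp at h2; nlinarith
  have hre : w / 2 ≤ z.re := by
    have := abs_le_of_sq_le_sq' (by nlinarith [sq_nonneg z.im] : (z.re - w) ^ 2 ≤ (w / 2) ^ 2)
      (by positivity)
    linarith [this.1]
  have hre2 : z.re ≤ 3 / 2 * w := by
    have := abs_le_of_sq_le_sq' (by nlinarith [sq_nonneg z.im] : (z.re - w) ^ 2 ≤ (w / 2) ^ 2)
      (by positivity)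
    linarith [this.2]
  have hz : 0 < z.re := by linarith
  refine (norm_amplitude_le hα hβ hγ hz hw (p := w / 2) (q := (1 + w) / 2) (by positivity)
    (by positivity) ?_ (hre.trans (Complex.re_le_norm z)) ?_).trans (le_of_eq ?_)
  · rw [Complex.normSq_apply]; nlinarith
  · refine le_trans ?_ (Complex.re_le_norm _)
    simp; linarith
  · have hw1 : 0 < 1 + w := by positivity
    have e1 : (w / 2) ^ (-α) = 2 ^ α * w ^ (-α) := by
      rw [Real.div_rpow hw.le zero_le_two, Real.rpow_neg zero_le_two α, div_inv_eq_mul, mul_comm]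
    have e2 : ((1 + w) / 2) ^ (-β) = 2 ^ β * (1 + w) ^ (-β) := by
      rw [Real.div_rpow hw1.le zero_le_two, Real.rpow_neg zero_le_two β, div_inv_eq_mul, mul_comm]
    rw [e1, e2, sub_eq_neg_add, Real.rpow_add hw1, Real.rpow_add two_pos]
    ring

lemma arg_eq_arctan {z : ℂ} (hz : 0 < z.re) : z.arg = Real.arctan (z.im / z.re) := by
  have h := (Complex.abs_arg_lt_pi_div_two_iff.mpr (Or.inl hz))
  rw [abs_lt] at h
  rw [← Complex.tan_arg, Real.arctan_tan h.1 h.2]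

lemma logRatio_im {z : ℂ} (hz : 0 < z.re) :
    (logRatio z).im = Real.arctan (z.im / (1 + z.re)) - Real.arctan (z.im / z.re) := by
  rw [logRatio, Complex.sub_im, Complex.log_im, Complex.log_im, arg_eq_arctan hz,
    arg_eq_arctan (one_add_re_pos hz)]
  simp

lemma arctan_sub_le {u v : ℝ} (h : u ≤ v) : Real.arctan v - Real.arctan u ≤ v - u := by
  have hd : ∀ x : ℝ, HasDerivAt (fun x => x - Real.arctan x) (1 - 1 / (1 + x ^ 2)) x :=
    fun x => (hasDerivAt_id x).sub (Real.hasDerivAt_arctan x)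
  have hm : Monotone (fun x => x - Real.arctan x) := by
    refine monotone_of_deriv_nonneg (fun x => (hd x).differentiableAt) fun x => ?_
    rw [(hd x).deriv, sub_nonneg, div_le_one (by positivity)]
    nlinarith [sq_nonneg x]
  have := hm h
  simp only at this; linarith

/-- The slope `1/(1+x²)` is at least `81/82` on `[0, 1/9]`; `1/9` is the largest ratio `|Im z|/Re z`
allowed in `le_logRatio_im`. -/
lemma le_arctan_sub {u v : ℝ} (h0 : 0 ≤ u) (h : u ≤ v) (hv : v ≤ 1 / 9) :
    81 / 82 * (v - u) ≤ Real.arctan v - Real.arctan u := by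
  have hd : ∀ x : ℝ, HasDerivAt (fun x => Real.arctan x - 81 / 82 * x)
      (1 / (1 + x ^ 2) - 81 / 82 * 1) x :=
    fun x => (Real.hasDerivAt_arctan x).sub ((hasDerivAt_id x).const_mul _)
  have hm : MonotoneOn (fun x => Real.arctan x - 81 / 82 * x) (Icc 0 (1 / 9)) := by
    refine monotoneOn_of_deriv_nonneg (convex_Icc _ _)
      (fun x _ => (hd x).continuousAt.continuousWithinAt)
      (fun x _ => (hd x).differentiableAt.differentiableWithinAt) fun x hx => ?_
    rw [interior_Icc] at hx
    rw [(hd x).deriv, sub_nonneg, le_div_iff₀ (by positivity)]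
    nlinarith [hx.1, hx.2]
  have := hm ⟨h0, h.trans hv⟩ ⟨h0.trans h, hv⟩ h
  simp only at this; linarith

lemma div_sub_div_one_add {x t : ℝ} (hx : 0 < x) :
    t / x - t / (1 + x) = t / (x * (1 + x)) := by
  field_simp; ring

/-- Below the real axis the imaginary part of `logRatio` is positive. -/
lemma le_logRatio_im {z : ℂ} {x t : ℝ} (hzx : z.re = x) (hzt : z.im = -t) (hx : 0 < x)
    (ht : 0 ≤ t) (htx : t ≤ x / 9) : 81 / 82 * (t / (x * (1 + x))) ≤ (logRatio z).im := by
  rw [logRatio_im (by rw [hzx]; exact hx), hzx, hzt, neg_div, neg_div, Real.arctan_neg,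
    Real.arctan_neg, ← div_sub_div_one_add hx]
  have := le_arctan_sub (u := t / (1 + x)) (v := t / x) (by positivity)
    (div_le_div_of_nonneg_left ht hx (by linarith)) (by rw [div_le_iff₀ hx]; linarith)
  linarith

/-- A lower bound for the imaginary part of `logRatio` above the real axis. -/
lemma neg_le_logRatio_im {z : ℂ} {x t : ℝ} (hzx : z.re = x) (hzt : z.im = t) (hx : 0 < x)
    (ht : 0 ≤ t) : -(t / (x * (1 + x))) ≤ (logRatio z).im := by
  rw [logRatio_im (by rw [hzx]; exact hx), hzx, hzt, ← div_sub_div_one_add hx]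
  have := arctan_sub_le (u := t / (1 + x)) (v := t / x)
    (div_le_div_of_nonneg_left ht hx (by linarith))
  linarith

end FirstIntegral

/-! ### Contour deformation -/

namespace FirstIntegral

open Set Metric Filter

/-- `|p - R| < R` means `|p|² < 2R Re p`: the discs tangent to the imaginary axis at `0` exhaust the
right half-plane. Each is convex and carries primitives, which is all that Cauchy's theorem requires
here. -/
lemma eventually_mem_ball {p : ℂ} (hp : 0 < p.re) :
    ∀ᶠ R : ℝ in atTop, p ∈ ball (R : ℂ) R := by
  filter_upwards [eventually_gt_atTop (Complex.normSq p / (2 * p.re)), eventually_gt_atTop 0]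
    with R hR hR0
  rw [div_lt_iff₀ (by positivity)] at hR
  rw [mem_ball, dist_eq_norm]
  refine lt_of_pow_lt_pow_left₀ 2 hR0.le ?_
  rw [← Complex.normSq_eq_norm_sq, Complex.normSq_apply]
  rw [Complex.normSq_apply] at hR
  simp
  nlinarith

lemma re_pos_of_mem_ball {R : ℝ} {z : ℂ} (hz : z ∈ ball (R : ℂ) R) : 0 < z.re := by
  rw [mem_ball, dist_eq_norm] at hz
  have := (abs_le.mp ((Complex.abs_re_le_norm (z - R)).trans hz.le)).1
  have h2 := (abs_lt.mp ((Complex.abs_re_le_norm (z - R)).trans_lt hz)).1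
  simp at h2
  linarith

/-- Reduces each contour identity to the cancellation of the values of one primitive at the corners.
-/
lemma integral_segment {B : Set ℂ} {f Φ : ℂ → ℂ} (hB : Convex ℝ B) (hf : ContinuousOn f B)
    (hΦ : ∀ z ∈ B, HasDerivAt Φ (f z) z) {p v : ℂ} {s t : ℝ} (hs : p + s * v ∈ B)
    (ht : p + t * v ∈ B) :
    v * ∫ x in s..t, f (p + x * v) = Φ (p + t * v) - Φ (p + s * v) := by
  have hmem : ∀ x ∈ uIcc s t, p + (x : ℂ) * v ∈ B := by
    have hc : Convex ℝ ((fun x : ℝ => p + (x : ℂ) * v) ⁻¹' B) := by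
      intro x hx y hy a b ha hb hab
      have := hB hx hy ha hb hab
      have e : a • (p + (x : ℂ) * v) + b • (p + (y : ℂ) * v)
          = p + ((a • x + b • y : ℝ) : ℂ) * v := by
        simp only [Complex.real_smul, smul_eq_mul, Complex.ofReal_add, Complex.ofReal_mul]
        have : (a : ℂ) + b = 1 := by exact_mod_cast hab
        linear_combination p * this
      simpa only [mem_preimage, ← e] using this
    have hsub := hc.ordConnected.uIcc_subset (x := s) (y := t) hs ht
    exact fun x hx => hsub hx
  have hd : ∀ x ∈ uIcc s t,
      HasDerivAt (fun x : ℝ => Φ (p + x * v)) (v * f (p + x * v)) x := by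
    intro x hx
    have h1 : HasDerivAt (fun x : ℝ => p + (x : ℂ) * v) v x := by
      simpa using ((Complex.ofRealCLM.hasDerivAt (x := x)).mul_const v).const_add p
    have := HasDerivAt.comp x (hΦ _ (hmem x hx)) h1
    rw [mul_comm] at this
    exact this
  rw [← intervalIntegral.integral_const_mul]
  refine intervalIntegral.integral_eq_sub_of_hasDerivAt hd ?_
  refine ContinuousOn.intervalIntegrable ?_
  refine continuousOn_const.mul (hf.comp (by fun_prop) hmem)

/-- Holomorphic functions on the right half-plane have a primitive on a convex set containing
finitely many given points. -/
lemma exists_primitive {f : ℂ → ℂ} (hf : DifferentiableOn ℂ f {z | 0 < z.re}) (S : Finset ℂ)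
    (hS : ∀ p ∈ S, 0 < p.re) :
    ∃ (B : Set ℂ) (Φ : ℂ → ℂ), Convex ℝ B ∧ ContinuousOn f B ∧
      (∀ z ∈ B, HasDerivAt Φ (f z) z) ∧ ∀ p ∈ S, p ∈ B := by
  have h : ∀ᶠ R : ℝ in atTop, ∀ p ∈ S, p ∈ ball (R : ℂ) R :=
    (Finset.eventually_all S).mpr fun p hp => eventually_mem_ball (hS p hp)
  obtain ⟨R, hR⟩ := h.exists
  have hd : DifferentiableOn ℂ f (ball (R : ℂ) R) := hf.mono fun z hz => re_pos_of_mem_ball hz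
  obtain ⟨Φ, hΦ⟩ := hd.isExactOn_ball
  exact ⟨_, Φ, convex_ball _ _, hd.continuousOn, hΦ, hR⟩

/-- The middle side lies on a ray from the origin, so the vertical sides have lengths `εa` and `εb`.
Both are parametrised downwards from the axis, hence the minus sign before the last one. -/
lemma contour_lower {f : ℂ → ℂ} (hf : DifferentiableOn ℂ f {z | 0 < z.re}) {a b ε : ℝ}
    (ha : 0 < a) (hb : 0 < b) :
    ∫ y in a..b, f y = -Complex.I * (∫ t in (0 : ℝ)..(ε * a), f (a + t * (-Complex.I))) +
      (1 - ε * Complex.I) * (∫ y in a..b, f (0 + y * (1 - ε * Complex.I))) -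
      -Complex.I * ∫ t in (0 : ℝ)..(ε * b), f (b + t * (-Complex.I)) := by
  obtain ⟨B, Φ, hB, hc, hΦ, hS⟩ := exists_primitive hf
    {(a : ℂ), (b : ℂ), a * (1 - ε * Complex.I), b * (1 - ε * Complex.I)}
    (by simp [ha, hb])
  simp only [Finset.mem_insert, Finset.mem_singleton, forall_eq_or_imp, forall_eq] at hS
  obtain ⟨h1, h2, h3, h4⟩ := hS
  have e1 := integral_segment hB hc hΦ (p := 0) (v := 1) (s := a) (t := b) (by simpa using h1)
    (by simpa using h2)
  have e2 := integral_segment hB hc hΦ (p := 0) (v := 1 - ε * Complex.I) (s := a) (t := b)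
    (by simpa using h3) (by simpa using h4)
  have k3 : (a : ℂ) + ((ε * a : ℝ) : ℂ) * (-Complex.I) = a * (1 - ε * Complex.I) := by
    push_cast; ring
  have k4 : (b : ℂ) + ((ε * b : ℝ) : ℂ) * (-Complex.I) = b * (1 - ε * Complex.I) := by
    push_cast; ring
  have e3 := integral_segment hB hc hΦ (p := a) (v := -Complex.I) (s := 0) (t := ε * a)
    (by simpa using h1) (by rw [k3]; exact h3)
  have e4 := integral_segment hB hc hΦ (p := b) (v := -Complex.I) (s := 0) (t := ε * b)
    (by simpa using h2) (by rw [k4]; exact h4)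
  rw [k3] at e3
  rw [k4] at e4
  rw [e2, e3, e4]
  simp only [mul_one, zero_add, one_mul, Complex.ofReal_zero, zero_mul, add_zero] at e1 ⊢
  rw [e1]; ring

/-- The slopes are forced: the segment through `w` ends at `w - (w/10)(1+i) = (9/10)w(1 - i/9)` and
at `w + (w/10)(1+i) = (11/10)w(1 + i/11)`, which must lie on the rays from the origin. -/
lemma contour_saddle {f : ℂ → ℂ} (hf : DifferentiableOn ℂ f {z | 0 < z.re}) {a b w : ℝ}
    (ha : 0 < a) (hb : 0 < b) (hw : 0 < w) :
    ∫ y in a..b, f y =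
      -Complex.I * (∫ t in (0 : ℝ)..(1 / 9 * a), f (a + t * (-Complex.I))) +
      (1 - ((1 / 9 : ℝ) : ℂ) * Complex.I) *
        (∫ y in a..(9 / 10 * w), f (0 + y * (1 - ((1 / 9 : ℝ) : ℂ) * Complex.I))) +
      (1 + Complex.I) * (∫ s in (-(w / 10))..(w / 10), f (w + s * (1 + Complex.I))) +
      (1 + ((1 / 11 : ℝ) : ℂ) * Complex.I) *
        (∫ y in (11 / 10 * w)..b, f (0 + y * (1 + ((1 / 11 : ℝ) : ℂ) * Complex.I))) -
      Complex.I * ∫ t in (0 : ℝ)..(1 / 11 * b), f (b + t * Complex.I) := by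
  obtain ⟨B, Φ, hB, hc, hΦ, hS⟩ := exists_primitive hf
    {(a : ℂ), (b : ℂ), a * (1 - ((1 / 9 : ℝ) : ℂ) * Complex.I),
      b * (1 + ((1 / 11 : ℝ) : ℂ) * Complex.I),
      ((9 / 10 * w : ℝ) : ℂ) * (1 - ((1 / 9 : ℝ) : ℂ) * Complex.I),
      ((11 / 10 * w : ℝ) : ℂ) * (1 + ((1 / 11 : ℝ) : ℂ) * Complex.I)}
    (by
      simp only [Finset.mem_insert, Finset.mem_singleton, forall_eq_or_imp, forall_eq,
        Complex.re_ofReal_mul, Complex.ofReal_re, Complex.sub_re, Complex.add_re, Complex.one_re,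
        Complex.I_re, mul_zero, sub_zero, add_zero, mul_one]
      exact ⟨ha, hb, ha, hb, by positivity, by positivity⟩)
  simp only [Finset.mem_insert, Finset.mem_singleton, forall_eq_or_imp, forall_eq] at hS
  obtain ⟨h1, h2, h3, h4, h5, h6⟩ := hS
  have k3 : (a : ℂ) + ((1 / 9 * a : ℝ) : ℂ) * (-Complex.I)
      = a * (1 - ((1 / 9 : ℝ) : ℂ) * Complex.I) := by
    push_cast; ring
  have k4 : (b : ℂ) + ((1 / 11 * b : ℝ) : ℂ) * Complex.I
      = b * (1 + ((1 / 11 : ℝ) : ℂ) * Complex.I) := by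
    push_cast; ring
  have k5 : (w : ℂ) + ((-(w / 10) : ℝ) : ℂ) * (1 + Complex.I)
      = ((9 / 10 * w : ℝ) : ℂ) * (1 - ((1 / 9 : ℝ) : ℂ) * Complex.I) := by
    push_cast; ring
  have k6 : (w : ℂ) + ((w / 10 : ℝ) : ℂ) * (1 + Complex.I)
      = ((11 / 10 * w : ℝ) : ℂ) * (1 + ((1 / 11 : ℝ) : ℂ) * Complex.I) := by
    push_cast; ring
  have e1 := integral_segment hB hc hΦ (p := 0) (v := 1) (s := a) (t := b) (by simpa using h1)
    (by simpa using h2)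
  have e2 := integral_segment hB hc hΦ (p := 0) (v := 1 - ((1 / 9 : ℝ) : ℂ) * Complex.I)
    (s := a) (t := 9 / 10 * w) (by rw [zero_add]; exact h3) (by rw [zero_add]; exact h5)
  have e3 := integral_segment hB hc hΦ (p := a) (v := -Complex.I) (s := 0) (t := 1 / 9 * a)
    (by simpa using h1) (by rw [k3]; exact h3)
  have e4 := integral_segment hB hc hΦ (p := b) (v := Complex.I) (s := 0) (t := 1 / 11 * b)
    (by simpa using h2) (by rw [k4]; exact h4)
  have e5 := integral_segment hB hc hΦ (p := w) (v := 1 + Complex.I) (s := -(w / 10))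
    (t := w / 10) (by rw [k5]; exact h5) (by rw [k6]; exact h6)
  have e6 := integral_segment hB hc hΦ (p := 0) (v := 1 + ((1 / 11 : ℝ) : ℂ) * Complex.I)
    (s := 11 / 10 * w) (t := b) (by rw [zero_add]; exact h6) (by rw [zero_add]; exact h4)
  rw [k3] at e3
  rw [k4] at e4
  rw [k5, k6] at e5
  rw [e2, e3, e4, e5, e6]
  simp only [mul_one, zero_add, one_mul, Complex.ofReal_zero, zero_mul, add_zero] at e1 ⊢
  rw [e1]; ring

end FirstIntegral

/-! ### Exponential decay along the deformed path -/

namespace FirstIntegral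

open Set

/-- The majorant for the integrand on the rays of the contour. -/
noncomputable def majorant (α β γ T k y : ℝ) : ℝ :=
  y ^ (-α) * (1 + y) ^ (γ - β) * Real.exp (-((T / (1 + y) + k * y) / 200))

lemma majorant_nonneg (α β γ T k : ℝ) {y : ℝ} (hy : 0 < y) : 0 ≤ majorant α β γ T k y := by
  unfold majorant; positivity

lemma continuousOn_majorant (α β γ T k : ℝ) :
    ContinuousOn (majorant α β γ T k) (Ioi 0) := by
  intro y hy
  have hy : 0 < y := hy
  have h1 : 1 + y ≠ 0 := by positivity
  unfold majorant
  refine ContinuousAt.continuousWithinAt ?_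
  refine ContinuousAt.mul (ContinuousAt.mul ?_ ?_) ?_
  · exact continuousAt_id.rpow_const (Or.inl hy.ne')
  · exact (continuousAt_const.add continuousAt_id).rpow_const (Or.inl h1)
  · have : ContinuousAt (fun y => T / (1 + y)) y :=
      continuousAt_const.div (continuousAt_const.add continuousAt_id) h1
    exact (((this.add (continuousAt_const.mul continuousAt_id)).div_const 200).neg).rexp

lemma intervalIntegrable_majorant (α β γ T k : ℝ) {p q : ℝ} (hp : 0 < p) (hq : 0 < q) :
    IntervalIntegrable (majorant α β γ T k) MeasureTheory.volume p q :=
  ((continuousOn_majorant α β γ T k).mono fun _ hx =>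
    (lt_min hp hq).trans_le hx.1).intervalIntegrable

variable {α β γ : ℝ}

lemma norm_ray_le (hα : 0 < α) (hβ : 0 < β) (hγ : 0 < γ) {T k κ y : ℝ} {z : ℂ} (hy : 0 < y)
    (hre : z.re = y) (him : 2 * z.im ^ 2 ≤ y ^ 2)
    (h : (T / (1 + y) + k * y) / 200 ≤ T * (logRatio z).im + 2 * Real.pi * κ * z.im) :
    ‖holIntegrand α β γ T κ z‖ ≤ (3 / 2) ^ γ * majorant α β γ T k y := by
  rw [norm_holIntegrand, majorant, ← mul_assoc]
  gcongr
  exact norm_amplitude_le_of_sector hα hβ hγ hy hre him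

/-- The factor `101/100` bounds `|v|`, since `|v|² ≤ 1 + 1/81`. -/
lemma norm_ray_integral_le (hα : 0 < α) (hβ : 0 < β) (hγ : 0 < γ) {T k κ p q : ℝ} {v : ℂ}
    (hp : 0 < p) (hpq : p ≤ q) (hre : v.re = 1) (him : |v.im| ≤ 1 / 9)
    (h : ∀ y ∈ Icc p q, (T / (1 + y) + k * y) / 200 ≤
      T * (logRatio (0 + y * v)).im + 2 * Real.pi * κ * (0 + y * v).im) :
    ‖v * ∫ y in p..q, holIntegrand α β γ T κ (0 + y * v)‖ ≤
      101 / 100 * ((3 / 2) ^ γ * ∫ y in p..q, majorant α β γ T k y) := by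
  have hv2 : v.im ^ 2 ≤ 1 / 81 := by
    have := pow_le_pow_left₀ (abs_nonneg _) him 2
    rw [sq_abs] at this; linarith
  have hv : ‖v‖ ≤ 101 / 100 := by
    refine le_of_pow_le_pow_left₀ two_ne_zero (by norm_num) ?_
    rw [← Complex.normSq_eq_norm_sq, Complex.normSq_apply, hre]
    nlinarith
  rw [norm_mul]
  refine mul_le_mul hv ?_ (norm_nonneg _) (by norm_num)
  rw [← intervalIntegral.integral_const_mul]
  refine intervalIntegral.norm_integral_le_of_norm_le hpq ?_
    ((intervalIntegrable_majorant α β γ T k hp (hp.trans_le hpq)).const_mul _)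
  refine MeasureTheory.ae_of_all _ fun y hy => ?_
  have hy0 : 0 < y := hp.trans hy.1
  refine norm_ray_le hα hβ hγ hy0 (by simp [hre]) ?_ (h y ⟨hy.1.le, hy.2⟩)
  simp only [zero_add, Complex.im_ofReal_mul]
  rw [mul_pow]
  nlinarith [sq_nonneg y]

lemma norm_integral_le_of_exp_decay {f : ℝ → ℂ} {h C μ : ℝ} (hh : 0 ≤ h) (hμ : 0 < μ) (hC : 0 ≤ C)
    (hf : ∀ t ∈ Icc 0 h, ‖f t‖ ≤ C * Real.exp (-(μ * t))) :
    ‖∫ t in (0 : ℝ)..h, f t‖ ≤ C / μ := by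
  have hd : ∀ x ∈ uIcc 0 h, HasDerivAt (fun t => -(C / μ) * Real.exp (-(μ * t)))
      (C * Real.exp (-(μ * x))) x := by
    intro x _
    have := ((((hasDerivAt_id' x).const_mul μ).neg).exp).const_mul (-(C / μ))
    refine this.congr_deriv ?_
    simp only [Pi.neg_apply]
    field_simp
  have hi : IntervalIntegrable (fun t => C * Real.exp (-(μ * t))) MeasureTheory.volume 0 h :=
    Continuous.intervalIntegrable (by fun_prop) _ _
  calc ‖∫ t in (0 : ℝ)..h, f t‖ ≤ ∫ t in (0 : ℝ)..h, C * Real.exp (-(μ * t)) :=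
        intervalIntegral.norm_integral_le_of_norm_le hh
          (MeasureTheory.ae_of_all _ fun t ht => hf t ⟨ht.1.le, ht.2⟩) hi
    _ = -(C / μ) * Real.exp (-(μ * h)) - -(C / μ) * Real.exp (-(μ * 0)) :=
        intervalIntegral.integral_eq_sub_of_hasDerivAt hd hi
    _ ≤ C / μ := by
        have : 0 ≤ C / μ * Real.exp (-(μ * h)) := by positivity
        simp only [mul_zero, neg_zero, Real.exp_zero]
        linarith

/-- The decay `exp(-μt)` at distance `t` from the axis makes a vertical side cost `1/μ` times the
amplitude bound at its foot, whatever its length. -/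
lemma norm_vertical_le (hα : 0 < α) (hβ : 0 < β) (hγ : 0 < γ) {T κ x h μ : ℝ} {v : ℂ}
    (hx : 0 < x) (hh : 0 ≤ h) (hhx : h ≤ x / 9) (hμ : 0 < μ) (hv : v.re = 0) (hv1 : |v.im| = 1)
    (hm : ∀ t ∈ Icc 0 h, μ * t ≤
      T * (logRatio (x + t * v)).im + 2 * Real.pi * κ * (x + t * v).im) :
    ‖∫ t in (0 : ℝ)..h, holIntegrand α β γ T κ (x + t * v)‖ ≤
      (3 / 2) ^ γ * (x ^ (-α) * (1 + x) ^ (γ - β)) / μ := by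
  refine norm_integral_le_of_exp_decay hh hμ (by positivity) fun t ht => ?_
  rw [norm_holIntegrand]
  have ham := norm_amplitude_le_of_sector hα hβ hγ (z := x + t * v) hx (by simp [hv]) (by
    have : v.im ^ 2 = 1 := by rw [← sq_abs, hv1, one_pow]
    have ht2 : t ≤ x / 9 := ht.2.trans hhx
    simp only [Complex.add_im, Complex.ofReal_im, Complex.im_ofReal_mul, zero_add, mul_pow, this]
    nlinarith [ht.1])
  gcongr
  exact hm t ht

/-- The logarithm contributes at least `(81/164)Tt/a` and `2πκt` removes at most `Tt/(4a)`, which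
leaves more than `Tt/(5a)`. For `κ = k` the hypothesis on `κ` is `a ≤ T/(8πk)`. -/
lemma norm_vertical_left_le (hα : 0 < α) (hβ : 0 < β) (hγ : 0 < γ) {T κ a : ℝ} (hT : 0 < T)
    (ha : 0 < a) (ha1 : a ≤ 1) (hκ : 2 * Real.pi * κ ≤ T / (4 * a)) :
    ‖-Complex.I * ∫ t in (0 : ℝ)..(1 / 9 * a), holIntegrand α β γ T κ (a + t * (-Complex.I))‖ ≤
      (3 / 2) ^ γ * (a ^ (-α) * (1 + a) ^ (γ - β)) / (T / (5 * a)) := by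
  rw [norm_mul, norm_neg, Complex.norm_I, one_mul]
  refine norm_vertical_le hα hβ hγ ha (by positivity) (by linarith) (by positivity) (by simp)
    (by simp) fun t ht => ?_
  have hL := le_logRatio_im (z := a + t * (-Complex.I)) (x := a) (t := t) (by simp) (by simp) ha
    ht.1 (by linarith [ht.2])
  have him : ((a : ℂ) + t * (-Complex.I)).im = -t := by simp
  rw [him]
  have h1 : t / (2 * a) ≤ t / (a * (1 + a)) :=
    div_le_div_of_nonneg_left ht.1 (by positivity) (by nlinarith)
  have h2 : T * (81 / 82 * (t / (2 * a))) ≤ T * (logRatio (a + t * (-Complex.I))).im :=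
    mul_le_mul_of_nonneg_left (le_trans (by linarith) hL) hT.le
  have h3 : 2 * Real.pi * κ * t ≤ T / (4 * a) * t := mul_le_mul_of_nonneg_right hκ ht.1
  have h4 : 0 ≤ T * t / a := by have := ht.1; positivity
  have e1 : T * (81 / 82 * (t / (2 * a))) = 81 / 164 * (T * t / a) := by field_simp; ring
  have e2 : T / (4 * a) * t = 1 / 4 * (T * t / a) := by field_simp
  have e3 : T / (5 * a) * t = 1 / 5 * (T * t / a) := by field_simp
  rw [e1] at h2
  rw [e2] at h3
  rw [e3]
  linarith

/-- Since `T ≤ b`, the logarithm removes at most `t ≤ kt` from `2πkt ≥ 6kt`. -/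
lemma norm_vertical_right_upper_le (hα : 0 < α) (hβ : 0 < β) (hγ : 0 < γ) {T k b : ℝ}
    (hk : 1 ≤ k) (hT : 0 < T) (hb : T ≤ b) :
    ‖Complex.I * ∫ t in (0 : ℝ)..(1 / 11 * b), holIntegrand α β γ T k (b + t * Complex.I)‖ ≤
      (3 / 2) ^ γ * (b ^ (-α) * (1 + b) ^ (γ - β)) / (5 * k) := by
  have hb0 : 0 < b := hT.trans_le hb
  rw [norm_mul, Complex.norm_I, one_mul]
  refine norm_vertical_le hα hβ hγ hb0 (by positivity) (by linarith) (by positivity) (by simp)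
    (by simp) fun t ht => ?_
  have hL := neg_le_logRatio_im (z := b + t * Complex.I) (x := b) (t := t) (by simp) (by simp)
    hb0 ht.1
  have him : ((b : ℂ) + t * Complex.I).im = t := by simp
  rw [him]
  have h1 : T * (t / (b * (1 + b))) ≤ t := by
    rw [mul_div_assoc', div_le_iff₀ (by positivity)]
    nlinarith [mul_le_mul_of_nonneg_right hb ht.1, mul_nonneg ht.1 (mul_nonneg hb0.le hb0.le)]
  have h2 := mul_le_mul_of_nonneg_left hL hT.le
  have h3 : t ≤ k * t := le_mul_of_one_le_left ht.1 hk
  have h4 : 3 * (k * t) ≤ Real.pi * (k * t) :=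
    mul_le_mul_of_nonneg_right Real.pi_gt_three.le (by have := ht.1; positivity)
  linarith

/-- Both parts of the phase help here; the rate `5k` is kept so that one boundary bound serves both
integrals. -/
lemma norm_vertical_right_lower_le (hα : 0 < α) (hβ : 0 < β) (hγ : 0 < γ) {T k b : ℝ}
    (hk : 1 ≤ k) (hT : 0 < T) (hb : T ≤ b) :
    ‖-Complex.I * ∫ t in (0 : ℝ)..(1 / 9 * b),
      holIntegrand α β γ T (-k) (b + t * (-Complex.I))‖ ≤
      (3 / 2) ^ γ * (b ^ (-α) * (1 + b) ^ (γ - β)) / (5 * k) := by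
  have hb0 : 0 < b := hT.trans_le hb
  rw [norm_mul, norm_neg, Complex.norm_I, one_mul]
  refine norm_vertical_le hα hβ hγ hb0 (by positivity) (by linarith) (by positivity) (by simp)
    (by simp) fun t ht => ?_
  have hL := le_logRatio_im (z := b + t * (-Complex.I)) (x := b) (t := t) (by simp) (by simp)
    hb0 ht.1 (by linarith [ht.2])
  have him : ((b : ℂ) + t * (-Complex.I)).im = -t := by simp
  rw [him]
  have ht0 := ht.1
  have h2 : 0 ≤ T * (logRatio (b + t * (-Complex.I))).im :=
    mul_nonneg hT.le (le_trans (by positivity) hL)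
  have h4 : 3 * (k * t) ≤ Real.pi * (k * t) :=
    mul_le_mul_of_nonneg_right Real.pi_gt_three.le (by positivity)
  nlinarith [mul_nonneg (by positivity : 0 ≤ k) ht0]

/-- Exponential decay on the ray below the real axis, for the phase without saddle point. -/
lemma decay_ray_lower_neg {T k y : ℝ} (hT : 0 < T) (hk : 0 < k) (hy : 0 < y) :
    (T / (1 + y) + k * y) / 200 ≤
      T * (logRatio (0 + y * (1 - ((1 / 9 : ℝ) : ℂ) * Complex.I))).im +
        2 * Real.pi * (-k) * (0 + y * (1 - ((1 / 9 : ℝ) : ℂ) * Complex.I)).im := by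
  have him : (0 + (y : ℂ) * (1 - ((1 / 9 : ℝ) : ℂ) * Complex.I)).im = -(y / 9) := by
    simp [-one_div, -Complex.ofReal_div, div_eq_mul_inv]
  have hre : (0 + (y : ℂ) * (1 - ((1 / 9 : ℝ) : ℂ) * Complex.I)).re = y := by
    simp [-one_div, -Complex.ofReal_div]
  have hL := le_logRatio_im hre him hy (by positivity) le_rfl
  rw [him]
  have e : y / 9 / (y * (1 + y)) = 1 / 9 * (1 / (1 + y)) := by field_simp
  rw [e] at hL
  have h2 := mul_le_mul_of_nonneg_left hL hT.le
  have h3 : 3 * (k * y) ≤ Real.pi * (k * y) :=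
    mul_le_mul_of_nonneg_right Real.pi_gt_three.le (by positivity)
  have h4 : T / (1 + y) = T * (1 / (1 + y)) := by ring
  have h5 : 0 < T * (1 / (1 + y)) := by positivity
  have h6 : 0 < k * y := by positivity
  rw [h4]
  linarith

/-- Exponential decay on the ray below the real axis, to the left of the saddle point. -/
lemma decay_ray_lower {T k w y : ℝ} (hk : 0 < k) (hw : 0 < w)
    (hs : 2 * Real.pi * k * (w * (1 + w)) = T) (hy : 0 < y) (hyw : y ≤ 9 / 10 * w) :
    (T / (1 + y) + k * y) / 200 ≤
      T * (logRatio (0 + y * (1 - ((1 / 9 : ℝ) : ℂ) * Complex.I))).im +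
        2 * Real.pi * k * (0 + y * (1 - ((1 / 9 : ℝ) : ℂ) * Complex.I)).im := by
  have hT : 0 < T := by rw [← hs]; positivity
  have him : (0 + (y : ℂ) * (1 - ((1 / 9 : ℝ) : ℂ) * Complex.I)).im = -(y / 9) := by
    simp [-one_div, -Complex.ofReal_div, div_eq_mul_inv]
  have hre : (0 + (y : ℂ) * (1 - ((1 / 9 : ℝ) : ℂ) * Complex.I)).re = y := by
    simp [-one_div, -Complex.ofReal_div]
  have hL := le_logRatio_im hre him hy (by positivity) le_rfl
  rw [him]
  have e : y / 9 / (y * (1 + y)) = 1 / 9 * (1 / (1 + y)) := by field_simp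
  rw [e] at hL
  have h2 := mul_le_mul_of_nonneg_left hL hT.le
  have h3 : 3 * (k * y) ≤ Real.pi * (k * y) :=
    mul_le_mul_of_nonneg_right Real.pi_gt_three.le (by positivity)
  have h4 : T / (1 + y) = T * (1 / (1 + y)) := by ring
  have h5 : 0 < T * (1 / (1 + y)) := by positivity
  have h6 : 0 < k * y := by positivity
  -- Left of the saddle `2πky(1+y) ≤ (9/10)T`, and `9/10 < 81/82`, so the logarithm still dominates.
  have h7 : Real.pi * (k * y) * 2 ≤ 9 / 10 * (T * (1 / (1 + y))) := by
    rw [mul_one_div, mul_div_assoc', le_div_iff₀ (by positivity), ← hs]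
    have : y * (1 + y) ≤ 9 / 10 * (w * (1 + w)) := by nlinarith
    calc Real.pi * (k * y) * 2 * (1 + y) = 2 * Real.pi * k * (y * (1 + y)) := by ring
      _ ≤ 2 * Real.pi * k * (9 / 10 * (w * (1 + w))) := by gcongr
      _ = _ := by ring
  rw [h4]
  linarith

/-- Exponential decay on the ray above the real axis, to the right of the saddle point. -/
lemma decay_ray_upper {T k w y : ℝ} (hk : 0 < k) (hw : 0 < w)
    (hs : 2 * Real.pi * k * (w * (1 + w)) = T) (hyw : 11 / 10 * w ≤ y) :
    (T / (1 + y) + k * y) / 200 ≤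
      T * (logRatio (0 + y * (1 + ((1 / 11 : ℝ) : ℂ) * Complex.I))).im +
        2 * Real.pi * k * (0 + y * (1 + ((1 / 11 : ℝ) : ℂ) * Complex.I)).im := by
  have hT : 0 < T := by rw [← hs]; positivity
  have hy : 0 < y := by linarith
  have him : (0 + (y : ℂ) * (1 + ((1 / 11 : ℝ) : ℂ) * Complex.I)).im = y / 11 := by
    simp [-one_div, -Complex.ofReal_div, div_eq_mul_inv]
  have hre : (0 + (y : ℂ) * (1 + ((1 / 11 : ℝ) : ℂ) * Complex.I)).re = y := by
    simp [-one_div, -Complex.ofReal_div]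
  have hL := neg_le_logRatio_im hre him hy (by positivity)
  rw [him]
  have e : y / 11 / (y * (1 + y)) = 1 / 11 * (1 / (1 + y)) := by field_simp
  rw [e] at hL
  have h2 := mul_le_mul_of_nonneg_left hL hT.le
  have h3 : 3 * (k * y) ≤ Real.pi * (k * y) :=
    mul_le_mul_of_nonneg_right Real.pi_gt_three.le (by positivity)
  have h4 : T / (1 + y) = T * (1 / (1 + y)) := by ring
  have h5 : 0 < T * (1 / (1 + y)) := by positivity
  have h6 : 0 < k * y := by positivity
  -- Right of the saddle the linear term exceeds `T/(1+y)` by a tenth of the latter; the decay comes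
  -- from this surplus.
  have h7 : 11 / 10 * (T * (1 / (1 + y))) ≤ Real.pi * (k * y) * 2 := by
    rw [mul_one_div, mul_div_assoc', div_le_iff₀ (by positivity), ← hs]
    have : 11 / 10 * (w * (1 + w)) ≤ y * (1 + y) := by nlinarith
    calc 11 / 10 * (2 * Real.pi * k * (w * (1 + w)))
        = 2 * Real.pi * k * (11 / 10 * (w * (1 + w))) := by ring
      _ ≤ 2 * Real.pi * k * (y * (1 + y)) := by gcongr
      _ = _ := by ring
  rw [h4]
  linarith

end FirstIntegral

/-! ### Integrals of the majorant over `[a,1]`, `[1,T]` and `[T,b]` -/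

namespace FirstIntegral

open Set MeasureTheory

variable {α β γ : ℝ}

lemma rpow_le_rpow_abs {r B : ℝ} (e : ℝ) (h1 : 1 ≤ r) (h2 : r ≤ B) : r ^ e ≤ B ^ |e| :=
  (Real.rpow_le_rpow_of_exponent_le h1 (le_abs_self e)).trans
    (Real.rpow_le_rpow (by linarith) h2 (abs_nonneg e))

/-- Isolates the power `y^(γ-α-β)` of the error terms; the cofactor is bounded as long as `y` stays
away from `0`. -/
lemma rpow_mul_one_add_rpow (α β γ : ℝ) {y : ℝ} (hy : 0 < y) :
    y ^ (-α) * (1 + y) ^ (γ - β) = y ^ (γ - α - β) * (1 + 1 / y) ^ (γ - β) := by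
  have e : 1 + 1 / y = (1 + y) / y := by field_simp; ring
  rw [e, Real.div_rpow (by positivity) hy.le, show γ - α - β = -α + (γ - β) by ring,
    Real.rpow_add hy]
  field_simp

lemma weight_le_of_le_one {y : ℝ} (hy : 0 < y) (hy1 : y ≤ 1) :
    y ^ (-α) * (1 + y) ^ (γ - β) ≤ 2 ^ |γ - β| * y ^ (-α) := by
  rw [mul_comm]
  gcongr
  exact rpow_le_rpow_abs _ (by linarith) (by linarith)

lemma weight_le_of_one_le {y : ℝ} (hy : 1 ≤ y) :
    y ^ (-α) * (1 + y) ^ (γ - β) ≤ 2 ^ |γ - β| * y ^ (γ - α - β) := by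
  have hy0 : 0 < y := by linarith
  rw [rpow_mul_one_add_rpow α β γ hy0, mul_comm]
  have h : 1 / y ≤ 1 := by rw [div_le_one hy0]; exact hy
  gcongr
  exact rpow_le_rpow_abs _ (by have : 0 < 1 / y := by positivity
                               linarith) (by linarith)

lemma integral_rpow_eq_delta (α β γ : ℝ) {T : ℝ} (hT : 1 ≤ T) :
    ∫ y in (1 : ℝ)..T, y ^ (γ - α - β) = delta α β γ T := by
  have h0 : (0 : ℝ) ∉ uIcc 1 T := by
    rw [uIcc_of_le hT]; intro h; linarith [h.1]
  unfold delta
  split_ifs with h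
  · rw [h]
    simp_rw [Real.rpow_neg_one]
    rw [integral_inv h0, div_one]
  · rw [integral_rpow (Or.inr ⟨h, h0⟩), Real.one_rpow]
    ring_nf

lemma delta_nonneg (α β γ : ℝ) {T : ℝ} (hT : 1 ≤ T) : 0 ≤ delta α β γ T := by
  rw [← integral_rpow_eq_delta α β γ hT]
  refine intervalIntegral.integral_nonneg hT fun y hy => ?_
  have : 0 < y := by linarith [hy.1]
  positivity

lemma intervalIntegrable_rpow_pos (e : ℝ) {p q : ℝ} (hp : 0 < p) (hq : 0 < q) :
    IntervalIntegrable (fun y : ℝ => y ^ e) volume p q :=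
  intervalIntegral.intervalIntegrable_rpow (Or.inr fun h => (lt_min hp hq).not_ge h.1)

/-- Far from the saddle point the phase is exponentially decaying in `√(Tk)`. -/
lemma integral_majorant_middle_le {T k : ℝ} (hT : 1 ≤ T) (hk : 1 ≤ k) :
    ∫ y in (1 : ℝ)..T, majorant α β γ T k y ≤
      2 ^ |γ - β| * delta α β γ T * Real.exp (-(√(T * k) / 200)) := by
  rw [← integral_rpow_eq_delta α β γ hT, ← intervalIntegral.integral_const_mul,
    ← intervalIntegral.integral_mul_const]
  have hT0 : 0 < T := by linarith
  refine intervalIntegral.integral_mono_on hT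
    (intervalIntegrable_majorant α β γ T k one_pos hT0)
    (((intervalIntegrable_rpow_pos _ one_pos hT0).const_mul _).mul_const _) fun y hy => ?_
  have hy0 : 0 < y := by linarith [hy.1]
  unfold majorant
  -- With `1 + y ≤ 2y`, AM-GM gives at least `T/(2y) + ky ≥ √(2Tk)`.
  have hexp : √(T * k) ≤ T / (1 + y) + k * y := by
    have h1 : T / (2 * y) ≤ T / (1 + y) :=
      div_le_div_of_nonneg_left hT0.le (by positivity) (by linarith [hy.1])
    refine le_trans ?_ (add_le_add_left h1 _)
    rw [Real.sqrt_le_left (by positivity)]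
    have e : (T / (2 * y) + k * y) ^ 2 = (T / (2 * y) - k * y) ^ 2 + 2 * (T * k) := by
      field_simp; ring
    rw [e]
    nlinarith [sq_nonneg (T / (2 * y) - k * y), mul_pos hT0 (by linarith : 0 < k)]
  exact mul_le_mul (weight_le_of_one_le hy.1) (Real.exp_le_exp.mpr (by linarith))
    (by positivity) (by positivity)

lemma rpow_le_max_rpow {e p q y : ℝ} (hp : 0 < p) (h1 : p ≤ y) (h2 : y ≤ q) :
    y ^ e ≤ max (q ^ e) (p ^ e) := by
  rcases le_total 0 e with h | h
  · exact (Real.rpow_le_rpow (hp.le.trans h1) h2 h).trans (le_max_left _ _)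
  · exact (Real.rpow_le_rpow_of_nonpos hp h1 h).trans (le_max_right _ _)

/-- Only `exp(-ky/200)` is kept; its integral from `T` on is at most `(200/k) exp(-Tk/200)`, and the
power of `y` is largest at an end of `[T,b]`. -/
lemma integral_majorant_far_le {T k b : ℝ} (hT : 1 ≤ T) (hk : 1 ≤ k) (hb : T ≤ b) :
    ∫ y in T..b, majorant α β γ T k y ≤
      2 ^ |γ - β| * max (b ^ (γ - α - β)) (T ^ (γ - α - β)) *
        (200 / k * Real.exp (-(T * k / 200))) := by
  have hT0 : 0 < T := by linarith
  have hk0 : 0 < k := by linarith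
  set Mx := max (b ^ (γ - α - β)) (T ^ (γ - α - β))
  have hM : 0 ≤ Mx := le_max_of_le_right (by positivity)
  have hi : IntervalIntegrable (fun y => 2 ^ |γ - β| * Mx * Real.exp (-(k / 200 * y))) volume T b :=
    Continuous.intervalIntegrable (by fun_prop) _ _
  have hd : ∀ x ∈ uIcc T b, HasDerivAt
      (fun y => -(2 ^ |γ - β| * Mx * (200 / k) * Real.exp (-(k / 200 * y))))
      (2 ^ |γ - β| * Mx * Real.exp (-(k / 200 * x))) x := by
    intro x _
    have := (((((hasDerivAt_id' x).const_mul (k / 200)).neg).exp).const_mul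
      (2 ^ |γ - β| * Mx * (200 / k))).neg
    refine this.congr_deriv ?_
    simp only [Pi.neg_apply]
    field_simp
  calc ∫ y in T..b, majorant α β γ T k y
      ≤ ∫ y in T..b, 2 ^ |γ - β| * Mx * Real.exp (-(k / 200 * y)) := by
        refine intervalIntegral.integral_mono_on hb
          (intervalIntegrable_majorant α β γ T k hT0 (hT0.trans_le hb)) hi fun y hy => ?_
        have hy1 : 1 ≤ y := hT.trans hy.1
        have hy0 : 0 < y := by linarith
        unfold majorant
        have h1 : 0 ≤ T / (1 + y) := by positivity
        have h2 := rpow_le_max_rpow (e := γ - α - β) hT0 hy.1 hy.2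
        have h3 := (weight_le_of_one_le (α := α) (β := β) (γ := γ) hy1).trans
          (mul_le_mul_of_nonneg_left h2 (by positivity))
        refine mul_le_mul h3 (Real.exp_le_exp.mpr (by linarith)) (by positivity) (by positivity)
    _ = -(2 ^ |γ - β| * Mx * (200 / k) * Real.exp (-(k / 200 * b)))
        - -(2 ^ |γ - β| * Mx * (200 / k) * Real.exp (-(k / 200 * T))) :=
        intervalIntegral.integral_eq_sub_of_hasDerivAt hd hi
    _ ≤ 2 ^ |γ - β| * Mx * (200 / k * Real.exp (-(T * k / 200))) := by
        have h0 : 0 ≤ 2 ^ |γ - β| * Mx * (200 / k) * Real.exp (-(k / 200 * b)) := by positivity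
        have e : k / 200 * T = T * k / 200 := by ring
        rw [e]
        linarith

lemma majorant_le_near {T k y : ℝ} (hT : 0 < T) (hy : 0 < y) (hy1 : y ≤ 1) :
    majorant α β γ T k y ≤ 2 ^ |γ - β| * Real.exp (-(T / 400)) *
      (y ^ (-α) * Real.exp (-(k / 200 * y))) := by
  unfold majorant
  have h1 : T / 2 ≤ T / (1 + y) := div_le_div_of_nonneg_left hT.le (by positivity) (by linarith)
  have h2 := weight_le_of_le_one (α := α) (β := β) (γ := γ) hy hy1
  calc y ^ (-α) * (1 + y) ^ (γ - β) * Real.exp (-((T / (1 + y) + k * y) / 200))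
      ≤ 2 ^ |γ - β| * y ^ (-α) * Real.exp (-(T / 400) + -(k / 200 * y)) := by
        gcongr
        linarith
    _ = _ := by rw [Real.exp_add]; ring

lemma integral_majorant_near_le_rpow (hα1 : α ≠ 1) {T k a : ℝ} (hT : 0 < T) (hk : 0 < k)
    (ha : 0 < a) (ha1 : a ≤ 1) :
    ∫ y in a..1, majorant α β γ T k y ≤
      2 ^ |γ - β| * Real.exp (-(T / 400)) * ((1 - a ^ (1 - α)) / (1 - α)) := by
  have e : ∫ y in a..1, y ^ (-α) = (1 - a ^ (1 - α)) / (1 - α) := by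
    rw [integral_rpow (Or.inr ⟨fun h => hα1 (by linarith), ?_⟩), Real.one_rpow]
    · ring_nf
    · rw [uIcc_of_le ha1]; intro h; linarith [h.1]
  rw [← e, ← intervalIntegral.integral_const_mul]
  refine intervalIntegral.integral_mono_on ha1
    (intervalIntegrable_majorant α β γ T k ha one_pos)
    ((intervalIntegrable_rpow_pos _ ha one_pos).const_mul _) fun y hy => ?_
  have hy0 : 0 < y := ha.trans_le hy.1
  refine (majorant_le_near hT hy0 hy.2).trans ?_
  gcongr
  refine mul_le_of_le_one_right (by positivity) (Real.exp_le_one_iff.mpr ?_)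
  have : 0 ≤ k / 200 * y := by positivity
  linarith

lemma integral_majorant_near_le_of_one_lt (hα1 : 1 < α) {T k a : ℝ} (hT : 0 < T) (hk : 0 < k)
    (ha : 0 < a) (ha1 : a ≤ 1) :
    ∫ y in a..1, majorant α β γ T k y ≤
      2 ^ |γ - β| * Real.exp (-(T / 400)) * (a ^ (1 - α) / (α - 1)) := by
  refine (integral_majorant_near_le_rpow hα1.ne' hT hk ha ha1).trans ?_
  gcongr ?_ * ?_
  rw [← neg_sub α 1, div_neg, ← neg_div]
  exact div_le_div_of_nonneg_right (by linarith) (by linarith)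

lemma integral_majorant_near_le_of_lt_one (hα1 : α < 1) {T k a : ℝ} (hT : 0 < T) (hk : 0 < k)
    (ha : 0 < a) (ha1 : a ≤ 1) :
    ∫ y in a..1, majorant α β γ T k y ≤
      2 ^ |γ - β| * Real.exp (-(T / 400)) * (1 / (1 - α)) := by
  refine (integral_majorant_near_le_rpow hα1.ne hT hk ha ha1).trans ?_
  have : 0 < a ^ (1 - α) := by positivity
  have : 0 < 1 - α := by linarith
  gcongr
  linarith

/-- `Γ(s) = Γ(s+1)/s`, and by convexity `Γ ≤ max(Γ(1), Γ(2)) = 1` on `[1,2]`. -/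
lemma Gamma_le_inv {s : ℝ} (h0 : 0 < s) (h1 : s ≤ 1) : Real.Gamma s ≤ 1 / s := by
  rw [le_div_iff₀ h0, mul_comm, ← Real.Gamma_add_one h0.ne']
  have := Real.convexOn_Gamma.le_max_of_mem_Icc (x := 1) (y := 2) (z := s + 1) (by simp) (by simp)
    ⟨by linarith, by linarith⟩
  simpa using this

/-- The range `k ≥ A'T` asks for the power `k^(α-1)`. It comes from keeping `exp(-ky/200)` and
extending the integral to `(0,∞)`, which converges because `α < 1`. -/
lemma integral_majorant_near_le_k (hα1 : α < 1) (hα : 0 < α) {T k a : ℝ} (hT : 0 < T) (hk : 0 < k)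
    (ha : 0 < a) (ha1 : a ≤ 1) :
    ∫ y in a..1, majorant α β γ T k y ≤
      2 ^ |γ - β| * Real.exp (-(T / 400)) * (200 * k ^ (α - 1) / (1 - α)) := by
  have hs : 0 < 1 - α := by linarith
  have hr : 0 < k / 200 := by positivity
  have hI := Real.integral_rpow_mul_exp_neg_mul_Ioi hs hr
  have hint : IntegrableOn (fun t : ℝ => t ^ (1 - α - 1) * Real.exp (-(k / 200 * t))) (Ioi 0) := by
    have := integrableOn_rpow_mul_exp_neg_mul_rpow (p := 1) (s := 1 - α - 1) (b := k / 200)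
      (by linarith) one_pos hr
    simpa using this
  have e1 : 1 - α - 1 = -α := by ring
  rw [e1] at hI hint
  have h1 : ∫ y in a..1, majorant α β γ T k y ≤
      2 ^ |γ - β| * Real.exp (-(T / 400)) *
        ∫ y in a..1, y ^ (-α) * Real.exp (-(k / 200 * y)) := by
    rw [← intervalIntegral.integral_const_mul]
    refine intervalIntegral.integral_mono_on ha1
      (intervalIntegrable_majorant α β γ T k ha one_pos)
      (((intervalIntegrable_rpow_pos _ ha one_pos).mul_continuousOn
        (by fun_prop)).const_mul _) fun y hy => ?_
    exact majorant_le_near hT (ha.trans_le hy.1) hy.2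
  refine h1.trans ?_
  gcongr
  rw [intervalIntegral.integral_of_le ha1]
  calc ∫ y in Ioc a 1, y ^ (-α) * Real.exp (-(k / 200 * y))
      ≤ ∫ y in Ioi (0 : ℝ), y ^ (-α) * Real.exp (-(k / 200 * y)) := by
        refine setIntegral_mono_set hint ?_
          (Ioc_subset_Ioi_self.trans (Ioi_subset_Ioi ha.le)).eventuallyLE
        refine (ae_restrict_mem measurableSet_Ioi).mono fun y hy => ?_
        have : (0 : ℝ) < y := hy
        simp only [Pi.zero_apply]
        positivity
    _ = (1 / (k / 200)) ^ (1 - α) * Real.Gamma (1 - α) := hI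
    _ ≤ (200 * k ^ (α - 1)) * (1 / (1 - α)) := by
        refine mul_le_mul ?_ (Gamma_le_inv hs (by linarith)) (Real.Gamma_pos_of_pos hs).le
          (by positivity)
        have e2 : 1 / (k / 200) = 200 * k⁻¹ := by field_simp
        rw [e2, Real.mul_rpow (by norm_num) (by positivity), Real.inv_rpow hk.le,
          ← Real.rpow_neg hk.le, neg_sub]
        gcongr
        calc (200 : ℝ) ^ (1 - α) ≤ 200 ^ (1 : ℝ) :=
              Real.rpow_le_rpow_of_exponent_le (by norm_num) (by linarith)
          _ = 200 := Real.rpow_one _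
    _ = _ := by ring

end FirstIntegral

/-! ### Local analysis at the saddle point -/

namespace FirstIntegral

open Set MeasureTheory Metric

/-- First and second order Taylor estimates for a bounded holomorphic function on a disc. -/
lemma norm_taylor_le {f : ℂ → ℂ} {c z : ℂ} {R M : ℝ} (hf : DifferentiableOn ℂ f (ball c R))
    (hM : ∀ u ∈ ball c R, ‖f u‖ ≤ M) (hz : z ∈ ball c R) :
    ‖f z - f c‖ ≤ 2 * M / R * ‖z - c‖ ∧
      ‖f z - f c - deriv f c * (z - c)‖ ≤ 4 * M / R ^ 2 * ‖z - c‖ ^ 2 := by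
  have hR : 0 < R := pos_of_mem_ball hz
  have hc : c ∈ ball c R := mem_ball_self hR
  -- The Schwarz lemma bounds the divided difference on the whole disc, without loss of radius.
  -- Applied to the divided difference itself, it gives the second order.
  have h1 : ∀ u ∈ ball c R, ‖dslope f c u‖ ≤ 2 * M / R := by
    intro u hu
    refine Complex.norm_dslope_le_div_of_mapsTo_ball hf (fun x hx => ?_) hu
    rw [mem_closedBall, dist_eq_norm]
    linarith [norm_sub_le (f x) (f c), hM x hx, hM c hc]
  have hd : DifferentiableOn ℂ (dslope f c) (ball c R) :=
    (Complex.differentiableOn_dslope (isOpen_ball.mem_nhds hc)).mpr hf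
  have h2 : ‖dslope (dslope f c) c z‖ ≤ 4 * M / R / R := by
    refine Complex.norm_dslope_le_div_of_mapsTo_ball hd (fun x hx => ?_) hz
    rw [mem_closedBall, dist_eq_norm]
    refine (norm_sub_le _ _).trans ((add_le_add (h1 x hx) (h1 c hc)).trans (le_of_eq ?_))
    ring
  have e1 : f z - f c = (z - c) * dslope f c z := by
    rw [← smul_eq_mul, sub_smul_dslope]
  have e2 : f z - f c - deriv f c * (z - c) = (z - c) ^ 2 * dslope (dslope f c) c z := by
    have := sub_smul_dslope (dslope f c) c z
    rw [smul_eq_mul, dslope_same f c] at this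
    rw [e1, pow_two, mul_assoc, this]; ring
  constructor
  · rw [e1, norm_mul, mul_comm]
    exact mul_le_mul_of_nonneg_right (h1 z hz) (norm_nonneg _)
  · rw [e2, norm_mul, norm_pow, mul_comm]
    refine (mul_le_mul_of_nonneg_right h2 (by positivity)).trans (le_of_eq ?_)
    field_simp

/-- The second derivative of the phase at the saddle point `w`. -/
noncomputable def curvature (T w : ℝ) : ℝ := T * (1 / w ^ 2 - 1 / (1 + w) ^ 2)

/-- The third Taylor coefficient of the phase at the saddle point `w`. -/
noncomputable def cubicCoeff (T w : ℝ) : ℝ := T / 3 * (1 / (1 + w) ^ 3 - 1 / w ^ 3)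

/-- The Taylor remainder of the phase at the saddle point `w` after the quadratic term. -/
noncomputable def phaseRemainder (T k w : ℝ) (ζ : ℂ) : ℂ :=
  phase T k (w + ζ) - phase T k w - (curvature T w / 2 : ℝ) * ζ ^ 2

/-- The saddle equation turns `2πk` into `T/(w(1+w))`, which kills the constant term of the
derivative of the phase. The curvature and the cubic coefficient kill the next two, and the rest is
an explicit rational function divisible by `ζ³`. -/
lemma hasDerivAt_phaseRemainder {T k w : ℝ} (hw : 0 < w)
    (hs : 2 * Real.pi * k * (w * (1 + w)) = T) {ζ : ℂ} (hζ : ‖ζ‖ ≤ w / 6) :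
    HasDerivAt (fun ζ => phaseRemainder T k w ζ - cubicCoeff T w * ζ ^ 3)
      (T * ζ ^ 3 * ((4 * w ^ 3 + 6 * w ^ 2 + 4 * w + 1) + ζ * (3 * w ^ 2 + 3 * w + 1)) /
        (w ^ 3 * (1 + w) ^ 3 * (w + ζ) * (1 + (w + ζ)))) ζ := by
  have hre : 0 < ((w : ℂ) + ζ).re := by
    have := (abs_le.mp ((Complex.abs_re_le_norm ζ).trans hζ)).1
    simp; linarith
  have h1 : HasDerivAt (fun ζ => phase T k (w + ζ))
      (T * ((1 + (w + ζ))⁻¹ - (w + ζ)⁻¹) + (2 * Real.pi * k : ℝ)) ζ := by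
    simpa using HasDerivAt.comp_const_add (w : ℂ) ζ (hasDerivAt_phase T k hre)
  have h2 := (((h1.sub_const (phase T k w)).sub
    ((hasDerivAt_pow 2 ζ).const_mul ((curvature T w / 2 : ℝ) : ℂ))).sub
    ((hasDerivAt_pow 3 ζ).const_mul (cubicCoeff T w : ℂ)))
  refine h2.congr_deriv ?_
  have n1 : (w : ℂ) + ζ ≠ 0 := ne_zero_of_re_pos hre
  have n2 : (1 : ℂ) + (w + ζ) ≠ 0 := ne_zero_of_re_pos (one_add_re_pos hre)
  have n3 : (w : ℂ) ≠ 0 := by exact_mod_cast hw.ne'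
  have n4 : (1 : ℂ) + w ≠ 0 := by exact_mod_cast (by positivity : 1 + w ≠ 0)
  have e : ((2 * Real.pi * k : ℝ) : ℂ) = T / (w * (1 + w)) := by
    rw [eq_div_iff (mul_ne_zero n3 n4), ← hs]; push_cast; ring
  rw [e, curvature, cubicCoeff]
  push_cast
  field_simp
  ring

/-- Mean value inequality on the disc of radius `|ζ|`. As `|ζ| ≤ w/6`, the denominators lose at most
a factor `5/6` each, and `(9/2)/(25/36) = 162/25 ≤ 7`. -/
lemma norm_phaseRemainder_sub_cubic_le {T k w : ℝ} (hT : 0 < T) (hw : 0 < w)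
    (hs : 2 * Real.pi * k * (w * (1 + w)) = T) {ζ : ℂ} (hζ : ‖ζ‖ ≤ w / 6) :
    ‖phaseRemainder T k w ζ - cubicCoeff T w * ζ ^ 3‖ ≤
      7 * (T / (1 + w)) * (‖ζ‖ / w) ^ 4 := by
  have h0 : phaseRemainder T k w 0 - cubicCoeff T w * 0 ^ 3 = 0 := by
    simp [phaseRemainder]
  have hb : ∀ u ∈ closedBall (0 : ℂ) ‖ζ‖,
      ‖T * u ^ 3 * ((4 * w ^ 3 + 6 * w ^ 2 + 4 * w + 1) + u * (3 * w ^ 2 + 3 * w + 1)) /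
        (w ^ 3 * (1 + w) ^ 3 * (w + u) * (1 + (w + u)))‖ ≤
      7 * (T / (1 + w)) * (‖ζ‖ ^ 3 / w ^ 4) := by
    intro u hu
    rw [mem_closedBall_zero_iff] at hu
    have hu6 : ‖u‖ ≤ w / 6 := hu.trans hζ
    have hure := (abs_le.mp ((Complex.abs_re_le_norm u).trans hu6)).1
    have b1 : 5 / 6 * w ≤ ‖(w : ℂ) + u‖ := by
      refine le_trans ?_ (Complex.re_le_norm _); simp; linarith
    have b2 : 5 / 6 * (1 + w) ≤ ‖(1 : ℂ) + (w + u)‖ := by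
      refine le_trans ?_ (Complex.re_le_norm _); simp; linarith
    have b3 : ‖((4 * w ^ 3 + 6 * w ^ 2 + 4 * w + 1 : ℂ) + u * (3 * w ^ 2 + 3 * w + 1))‖ ≤
        9 / 2 * (1 + w) ^ 3 := by
      have e1 : (4 * w ^ 3 + 6 * w ^ 2 + 4 * w + 1 : ℂ) =
        ((4 * w ^ 3 + 6 * w ^ 2 + 4 * w + 1 : ℝ) : ℂ) := by push_cast; rfl
      have e2 : (3 * w ^ 2 + 3 * w + 1 : ℂ) = ((3 * w ^ 2 + 3 * w + 1 : ℝ) : ℂ) := by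
        push_cast; rfl
      refine (norm_add_le _ _).trans ?_
      rw [norm_mul, e1, e2, Complex.norm_of_nonneg (by positivity),
        Complex.norm_of_nonneg (by positivity)]
      have : ‖u‖ * (3 * w ^ 2 + 3 * w + 1) ≤ w / 6 * (3 * w ^ 2 + 3 * w + 1) := by gcongr
      nlinarith [pow_pos hw 2, pow_pos hw 3]
    have e4 : ‖(w : ℂ) ^ 3 * (1 + w) ^ 3‖ = w ^ 3 * (1 + w) ^ 3 := by
      rw [show (w : ℂ) ^ 3 * (1 + w) ^ 3 = ((w ^ 3 * (1 + w) ^ 3 : ℝ) : ℂ) by push_cast; rfl,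
        Complex.norm_of_nonneg (by positivity)]
    rw [norm_div, norm_mul, norm_mul, norm_mul, norm_mul, e4, norm_pow,
      Complex.norm_of_nonneg hT.le]
    calc T * ‖u‖ ^ 3 * ‖((4 * w ^ 3 + 6 * w ^ 2 + 4 * w + 1 : ℂ) + u * (3 * w ^ 2 + 3 * w + 1))‖ /
          (w ^ 3 * (1 + w) ^ 3 * ‖(w : ℂ) + u‖ * ‖(1 : ℂ) + (w + u)‖)
        ≤ T * ‖ζ‖ ^ 3 * (9 / 2 * (1 + w) ^ 3) /
          (w ^ 3 * (1 + w) ^ 3 * (5 / 6 * w) * (5 / 6 * (1 + w))) := by gcongr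
      _ = 162 / 25 * (T / (1 + w)) * (‖ζ‖ ^ 3 / w ^ 4) := by field_simp; ring
      _ ≤ _ := by gcongr; norm_num
  have hmv := (convex_closedBall (0 : ℂ) ‖ζ‖).norm_image_sub_le_of_norm_hasDerivWithin_le
    (f := fun ζ => phaseRemainder T k w ζ - cubicCoeff T w * ζ ^ 3)
    (fun u hu => (hasDerivAt_phaseRemainder hw hs
      ((mem_closedBall_zero_iff.mp hu).trans hζ)).hasDerivWithinAt) hb
    (x := 0) (y := ζ) (by simp) (by simp)
  rw [h0, sub_zero, sub_zero] at hmv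
  refine hmv.trans (le_of_eq ?_)
  field_simp

lemma abs_cubicCoeff_le {T w : ℝ} (hT : 0 < T) (hw : 0 < w) :
    |cubicCoeff T w| ≤ T / (1 + w) / w ^ 3 := by
  have e : cubicCoeff T w = -(T / (1 + w) / w ^ 3 * ((3 * w ^ 2 + 3 * w + 1) /
      (3 * (1 + w) ^ 2))) := by
    unfold cubicCoeff; field_simp; ring
  rw [e, abs_neg, abs_of_nonneg (by positivity)]
  refine mul_le_of_le_one_right (by positivity) ?_
  rw [div_le_one (by positivity)]
  nlinarith

/-- For `|ζ| ≤ w/7` the quartic bound `7(|ζ|/w)⁴` is at most `(|ζ|/w)³`, the size of the cubic term.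
-/
lemma norm_phaseRemainder_le {T k w : ℝ} (hT : 0 < T) (hw : 0 < w)
    (hs : 2 * Real.pi * k * (w * (1 + w)) = T) {ζ : ℂ} (hζ : ‖ζ‖ ≤ w / 7) :
    ‖phaseRemainder T k w ζ‖ ≤ 2 * (T / (1 + w)) * (‖ζ‖ / w) ^ 3 := by
  have h1 := norm_phaseRemainder_sub_cubic_le hT hw hs (hζ.trans (by linarith))
  have h2 : ‖(cubicCoeff T w : ℂ) * ζ ^ 3‖ ≤ T / (1 + w) * (‖ζ‖ / w) ^ 3 := by
    rw [norm_mul, norm_pow, Complex.norm_real, Real.norm_eq_abs]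
    refine (mul_le_mul_of_nonneg_right (abs_cubicCoeff_le hT hw) (by positivity)).trans
      (le_of_eq ?_)
    field_simp
  have h3 := norm_add_le (phaseRemainder T k w ζ - cubicCoeff T w * ζ ^ 3)
    ((cubicCoeff T w : ℂ) * ζ ^ 3)
  rw [sub_add_cancel] at h3
  have hr : ‖ζ‖ / w ≤ 1 / 7 := by rw [div_le_iff₀ hw]; linarith
  have h4 : 7 * (T / (1 + w)) * (‖ζ‖ / w) ^ 4 ≤ T / (1 + w) * (‖ζ‖ / w) ^ 3 := by
    have : 7 * (T / (1 + w)) * (‖ζ‖ / w) ^ 4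
      = T / (1 + w) * (‖ζ‖ / w) ^ 3 * (7 * (‖ζ‖ / w)) := by ring
    rw [this]
    exact mul_le_of_le_one_right (by positivity) (by linarith)
  linarith

lemma le_curvature {T w : ℝ} (hT : 0 < T) (hw : 0 < w) :
    T / (1 + w) / w ^ 2 ≤ curvature T w := by
  have e : curvature T w = T / (1 + w) / w ^ 2 * ((1 + 2 * w) / (1 + w)) := by
    unfold curvature; field_simp; ring
  rw [e]
  refine le_mul_of_one_le_right (by positivity) ?_
  rw [one_le_div (by positivity)]; linarith

lemma norm_exp_sub_one_sub_le (x : ℂ) :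
    ‖Complex.exp x - 1 - x‖ ≤ ‖x‖ ^ 2 * Real.exp ‖x‖ := by
  have := Complex.norm_exp_sub_sum_le_norm_mul_exp x 2
  simpa [Finset.sum_range_succ, sub_sub] using this

/-- Pointwise comparison of the integrand near the saddle point with its leading part; the terms
`D` and `G₀ C` are odd and do not contribute to the integral. -/
lemma norm_saddle_pointwise_le {G G₀ D Q C : ℂ} {M Λ r : ℝ} (hr : 0 ≤ r) (hr7 : r ≤ 1 / 7)
    (hΛ : 0 < Λ) (hG : ‖G‖ ≤ M) (hG₀ : ‖G₀‖ ≤ M) (h1 : ‖G - G₀‖ ≤ 4 * M * r)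
    (h2 : ‖G - G₀ - D‖ ≤ 16 * M * r ^ 2) (hQ : ‖Q‖ ≤ 2 * Λ * r ^ 3)
    (hQC : ‖Q - C‖ ≤ 7 * Λ * r ^ 4) :
    ‖G * Complex.exp (Complex.I * Q) - G₀ - (D + G₀ * (Complex.I * C))‖ *
      Real.exp (-(Λ * r ^ 2 / 2)) ≤ 16000 * M / Λ * Real.exp (-(Λ * r ^ 2 / 20)) := by
  have hM : 0 ≤ M := (norm_nonneg G).trans hG
  set u := Λ * r ^ 2 with hu
  have hu0 : 0 ≤ u := by positivity
  have hIQ : ‖Complex.I * Q‖ = ‖Q‖ := by rw [norm_mul, Complex.norm_I, one_mul]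
  -- As `2/7 < 1/2`, the factor `exp(iQ)` cannot destroy the Gaussian `exp(-u/2)`.
  have hQu : ‖Q‖ ≤ 2 / 7 * u := by
    refine hQ.trans ?_
    have : 2 * Λ * r ^ 3 = 2 * u * r := by rw [hu]; ring
    rw [this]; nlinarith
  have e : G * Complex.exp (Complex.I * Q) - G₀ - (D + G₀ * (Complex.I * C)) =
      G * (Complex.exp (Complex.I * Q) - 1 - Complex.I * Q) + (G - G₀) * (Complex.I * Q) +
        G₀ * (Complex.I * (Q - C)) + (G - G₀ - D) := by ring
  have t1 : ‖G * (Complex.exp (Complex.I * Q) - 1 - Complex.I * Q)‖ ≤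
      M * ((2 * Λ * r ^ 3) ^ 2 * Real.exp (2 / 7 * u)) := by
    rw [norm_mul]
    refine mul_le_mul hG ((norm_exp_sub_one_sub_le _).trans ?_) (norm_nonneg _) hM
    rw [hIQ]
    gcongr
  have t2 : ‖(G - G₀) * (Complex.I * Q)‖ ≤ 4 * M * r * (2 * Λ * r ^ 3) := by
    rw [norm_mul, hIQ]; gcongr
  have t3 : ‖G₀ * (Complex.I * (Q - C))‖ ≤ M * (7 * Λ * r ^ 4) := by
    rw [norm_mul, norm_mul, Complex.norm_I, one_mul]; gcongr
  have hexp : 1 ≤ Real.exp (2 / 7 * u) := Real.one_le_exp (by positivity)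
  have hsum : ‖G * Complex.exp (Complex.I * Q) - G₀ - (D + G₀ * (Complex.I * C))‖ ≤
      M * r ^ 2 * (4 * u ^ 2 + 15 * u + 16) * Real.exp (2 / 7 * u) := by
    rw [e]
    refine (norm_add₄_le).trans ((add_le_add (add_le_add (add_le_add t1 t2) t3) h2).trans ?_)
    have e1 : M * ((2 * Λ * r ^ 3) ^ 2 * Real.exp (2 / 7 * u)) =
        M * r ^ 2 * (4 * u ^ 2) * Real.exp (2 / 7 * u) := by rw [hu]; ring
    have e2 : 4 * M * r * (2 * Λ * r ^ 3) + M * (7 * Λ * r ^ 4) + 16 * M * r ^ 2 =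
        M * r ^ 2 * (15 * u + 16) := by rw [hu]; ring
    have e3 : M * r ^ 2 * (15 * u + 16) ≤ M * r ^ 2 * (15 * u + 16) * Real.exp (2 / 7 * u) :=
      le_mul_of_one_le_right (by positivity) hexp
    rw [e1]
    linarith
  have hq : 4 * u ^ 2 + 15 * u + 16 ≤ 800 * Real.exp (u / 10) := by
    have := Real.quadratic_le_exp_of_nonneg (by positivity : 0 ≤ u / 10)
    nlinarith
  have hl : u ≤ 20 * Real.exp (u / 20) := by
    have := Real.add_one_le_exp (u / 20)
    linarith
  -- The spare factor `r²` is the gain `1/Λ`. The polynomials in `u` cost `exp(u/20)` and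
  -- `exp(u/10)`, and `1/20 + 1/10 + 2/7 - 1/2 < -1/20`.
  have hr2 : r ^ 2 = u / Λ := by rw [hu]; field_simp
  calc _ ≤ M * r ^ 2 * (4 * u ^ 2 + 15 * u + 16) * Real.exp (2 / 7 * u) *
        Real.exp (-(u / 2)) := by gcongr
    _ ≤ M * (20 * Real.exp (u / 20) / Λ) * (800 * Real.exp (u / 10)) * Real.exp (2 / 7 * u) *
        Real.exp (-(u / 2)) := by rw [hr2]; gcongr
    _ = 16000 * M / Λ * Real.exp (u / 20 + u / 10 + 2 / 7 * u + -(u / 2)) := by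
        rw [Real.exp_add, Real.exp_add, Real.exp_add]; ring
    _ ≤ 16000 * M / Λ * Real.exp (-(u / 20)) := by
        gcongr
        linarith

lemma integral_odd_eq_zero {g : ℝ → ℂ} (hg : ∀ s, g (-s) = -g s) (h : ℝ) :
    ∫ s in (-h)..h, g s = 0 := by
  have h1 := intervalIntegral.integral_comp_neg (a := -h) (b := h) g
  simp only [hg, neg_neg, intervalIntegral.integral_neg] at h1
  have h2 : (2 : ℂ) * ∫ s in (-h)..h, g s = 0 := by linear_combination -h1
  simpa using h2

/-- Outside `[-h,h]`, `exp(-Qs²) ≤ exp(-Qh²/2) exp(-Qs²/2)`, and `exp(-x) ≤ 1/x`. The lower bound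
`Q` for `q` lets the estimate be expressed through `Λ`. -/
lemma gaussian_tail_le {q Q h : ℝ} (hQ : 0 < Q) (hqQ : Q ≤ q) (hh : 0 < h) :
    |√(Real.pi / q) - ∫ s in (-h)..h, Real.exp (-q * s ^ 2)| ≤
      2 / (Q * h ^ 2) * √(Real.pi / (Q / 2)) := by
  have hq : 0 < q := hQ.trans_le hqQ
  have hi := integrable_exp_neg_mul_sq hq
  have hi2 := integrable_exp_neg_mul_sq (half_pos hQ)
  rw [← integral_gaussian q, intervalIntegral.integral_of_le (by linarith : -h ≤ h),
    ← integral_add_compl (measurableSet_Ioc (a := -h) (b := h)) hi, add_sub_cancel_left,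
    abs_of_nonneg (integral_nonneg fun _ => (Real.exp_pos _).le), ← integral_gaussian (Q / 2),
    ← integral_const_mul]
  calc ∫ s in (Ioc (-h) h)ᶜ, Real.exp (-q * s ^ 2)
      ≤ ∫ s in (Ioc (-h) h)ᶜ, 2 / (Q * h ^ 2) * Real.exp (-(Q / 2) * s ^ 2) := by
        refine setIntegral_mono_on hi.integrableOn (hi2.const_mul _).integrableOn
          measurableSet_Ioc.compl fun s hs => ?_
        have hs2 : h ^ 2 ≤ s ^ 2 := by
          rw [mem_compl_iff, mem_Ioc, not_and_or, not_lt, not_le] at hs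
          rcases hs with hs | hs <;> nlinarith
        have hx : 0 < Q * h ^ 2 / 2 := by positivity
        have h1 : Real.exp (-(Q * h ^ 2 / 2)) ≤ 2 / (Q * h ^ 2) := by
          rw [Real.exp_neg, inv_le_comm₀ (Real.exp_pos _) (by positivity), inv_div]
          linarith [Real.add_one_le_exp (Q * h ^ 2 / 2)]
        calc Real.exp (-q * s ^ 2) ≤ Real.exp (-(Q * h ^ 2 / 2) + -(Q / 2) * s ^ 2) := by
              refine Real.exp_le_exp.mpr ?_
              nlinarith [mul_le_mul_of_nonneg_right hqQ (sq_nonneg s),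
                mul_le_mul_of_nonneg_left hs2 hQ.le]
          _ ≤ _ := by rw [Real.exp_add]; gcongr
    _ ≤ ∫ s, 2 / (Q * h ^ 2) * Real.exp (-(Q / 2) * s ^ 2) := by
        refine setIntegral_le_integral (hi2.const_mul _) (Filter.Eventually.of_forall fun s => ?_)
        simp only [Pi.zero_apply]
        positivity

end FirstIntegral

/-! ### The segment through the saddle point -/

namespace FirstIntegral

open Set MeasureTheory Metric

lemma norm_smul_one_add_I (s : ℝ) : ‖(s : ℂ) * (1 + Complex.I)‖ = √2 * |s| := by
  have h : ‖(1 + Complex.I : ℂ)‖ = √2 := by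
    rw [Complex.norm_def]; congr 1; simp [Complex.normSq_apply]; norm_num
  rw [norm_mul, h, Complex.norm_real, Real.norm_eq_abs, mul_comm]

/-- In the direction `1 + i` one has `ζ² = 2is²`, so the quadratic part of the phase becomes the
real Gaussian `exp(-qs²)`, with `q` the curvature. -/
lemma holIntegrand_saddle (α β γ T k w s : ℝ) :
    holIntegrand α β γ T k (w + s * (1 + Complex.I)) =
      Complex.exp (Complex.I * phase T k w) *
        ((amplitude α β γ (w + s * (1 + Complex.I)) *
          Complex.exp (Complex.I * phaseRemainder T k w (s * (1 + Complex.I)))) *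
          (Real.exp (-curvature T w * s ^ 2) : ℂ)) := by
  have hsq : ((s : ℂ) * (1 + Complex.I)) ^ 2 = 2 * Complex.I * s ^ 2 := by
    have := Complex.I_sq
    linear_combination (s : ℂ) ^ 2 * this
  have e : Complex.I * phase T k (w + s * (1 + Complex.I)) = Complex.I * phase T k w +
      Complex.I * phaseRemainder T k w (s * (1 + Complex.I)) +
      ((-curvature T w * s ^ 2 : ℝ) : ℂ) := by
    rw [phaseRemainder, hsq]
    push_cast
    have := Complex.I_sq
    linear_combination (curvature T w : ℂ) * s ^ 2 * this
  rw [holIntegrand, e, Complex.exp_add, Complex.exp_add, Complex.ofReal_exp]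
  ring

/-- The contribution of the segment through the saddle point. -/
theorem norm_saddle_segment_le {α β γ : ℝ} (hα : 0 < α) (hβ : 0 < β) (hγ : 0 < γ) {T k w : ℝ}
    (hT : 0 < T) (hw : 0 < w) (hs : 2 * Real.pi * k * (w * (1 + w)) = T) :
    ‖(1 + Complex.I) * (∫ s in (-(w / 10))..(w / 10),
        holIntegrand α β γ T k (w + s * (1 + Complex.I))) -
      (1 + Complex.I) * (holIntegrand α β γ T k w * (√(Real.pi / curvature T w) : ℝ))‖ ≤
      200000 * (2 ^ (α + β) * (3 / 2) ^ γ * (w ^ (-α) * (1 + w) ^ (γ - β))) *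
        (w / (T / (1 + w) * √(T / (1 + w)))) := by
  set M := 2 ^ (α + β) * (3 / 2) ^ γ * (w ^ (-α) * (1 + w) ^ (γ - β)) with hMdef
  set Λ := T / (1 + w) with hΛdef
  set q := curvature T w with hqdef
  have hM : 0 ≤ M := by positivity
  have hΛ : 0 < Λ := by positivity
  have hq : Λ / w ^ 2 ≤ q := le_curvature hT hw
  set G₀ := amplitude α β γ w with hG₀
  set D := deriv (amplitude α β γ) w with hD
  set C₃ := cubicCoeff T w
  set h := w / 10 with hh
  have hh0 : 0 < h := by positivity
  have hball : ball (w : ℂ) (w / 2) ⊆ {z | 0 < z.re} := by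
    intro z hz
    rw [mem_ball, dist_eq_norm] at hz
    have := (abs_le.mp ((Complex.abs_re_le_norm (z - w)).trans hz.le)).1
    simp at this ⊢; linarith
  have hGd : DifferentiableOn ℂ (amplitude α β γ) (ball (w : ℂ) (w / 2)) :=
    (differentiableOn_amplitude α β γ).mono hball
  have hGM : ∀ u ∈ ball (w : ℂ) (w / 2), ‖amplitude α β γ u‖ ≤ M := fun u hu =>
    norm_amplitude_le_of_disc hα hβ hγ hw (by
      rw [mem_ball, dist_eq_norm] at hu; exact hu.le)
  set ζ : ℝ → ℂ := fun s => s * (1 + Complex.I) with hζ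
  have hζn : ∀ s, ‖ζ s‖ = √2 * |s| := norm_smul_one_add_I
  -- Together with `|s| ≤ w/10` this keeps `|ζ| ≤ w/7`.
  have hsqrt2 : √2 ≤ 10 / 7 := by
    rw [Real.sqrt_le_left (by norm_num)]; norm_num
  have hζ7 : ∀ s ∈ Icc (-h) h, ‖ζ s‖ ≤ w / 7 := by
    intro s hs
    rw [hζn]
    have : |s| ≤ h := abs_le.mpr hs
    calc √2 * |s| ≤ 10 / 7 * h := by gcongr
      _ = w / 7 := by rw [hh]; ring
  have hmem : ∀ s ∈ Icc (-h) h, (w : ℂ) + ζ s ∈ ball (w : ℂ) (w / 2) := by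
    intro s hs
    rw [mem_ball, dist_eq_norm, add_sub_cancel_left]
    linarith [hζ7 s hs]
  have hζc : Continuous ζ := by fun_prop
  set g : ℝ → ℂ := fun s => amplitude α β γ (w + ζ s) *
    Complex.exp (Complex.I * phaseRemainder T k w (ζ s)) with hg
  have hgc : ContinuousOn g (Icc (-h) h) := by
    have c1 : ContinuousOn (fun s => amplitude α β γ (w + ζ s)) (Icc (-h) h) :=
      hGd.continuousOn.comp (by fun_prop) hmem
    have c2 : ContinuousOn (phase T k) {z | 0 < z.re} := fun z hz =>
      (hasDerivAt_phase T k hz).continuousAt.continuousWithinAt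
    have c3 : ContinuousOn (fun s => phase T k (w + ζ s)) (Icc (-h) h) :=
      c2.comp (by fun_prop) fun s hs => hball (hmem s hs)
    have c4 : ContinuousOn (fun s => phaseRemainder T k w (ζ s)) (Icc (-h) h) :=
      (c3.sub continuousOn_const).sub
        (continuousOn_const.mul (hζc.continuousOn.pow 2))
    exact c1.mul (continuousOn_const.mul c4).cexp
  -- Linear part of the amplitude and cubic part of the phase. Estimated in absolute value they
  -- would cost a relative error `Λ^(-1/2)`; being odd, they cost nothing.
  set odd : ℝ → ℂ := fun s => D * ζ s + G₀ * (Complex.I * (C₃ * ζ s ^ 3)) with hodd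
  set E : ℝ → ℂ := fun s => (Real.exp (-q * s ^ 2) : ℂ) with hE
  have hEc : Continuous E := by rw [hE]; fun_prop
  have hoddc : Continuous odd := by rw [hodd]; fun_prop
  have i1 : IntervalIntegrable (fun s => g s * E s) volume (-h) h := by
    refine ContinuousOn.intervalIntegrable ?_
    rw [uIcc_of_le (by linarith)]
    exact hgc.mul hEc.continuousOn
  have i2 : IntervalIntegrable (fun s => G₀ * E s) volume (-h) h :=
    (continuous_const.mul hEc).intervalIntegrable _ _
  have i3 : IntervalIntegrable (fun s => odd s * E s) volume (-h) h :=
    (hoddc.mul hEc).intervalIntegrable _ _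
  have hodd0 : ∫ s in (-h)..h, odd s * E s = 0 := by
    refine integral_odd_eq_zero (fun s => ?_) h
    simp only [hodd, hE, hζ, Complex.ofReal_neg, neg_sq]
    ring
  have hsplit : (∫ s in (-h)..h, g s * E s) - G₀ * ∫ s in (-h)..h, E s =
      ∫ s in (-h)..h, (g s - G₀ - odd s) * E s := by
    have e : ∀ s, (g s - G₀ - odd s) * E s = g s * E s - G₀ * E s - odd s * E s := fun s => by
      ring
    simp_rw [e]
    rw [intervalIntegral.integral_sub (i1.sub i2) i3, intervalIntegral.integral_sub i1 i2, hodd0,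
      intervalIntegral.integral_const_mul, sub_zero]
  have hb : 0 < Λ / (10 * w ^ 2) := by positivity
  have hsqrtΛ : 0 < √Λ := Real.sqrt_pos.mpr hΛ
  have hmain : ‖∫ s in (-h)..h, (g s - G₀ - odd s) * E s‖ ≤
      16000 * M / Λ * (6 * w / √Λ) := by
    have hint : Integrable (fun s => 16000 * M / Λ * Real.exp (-(Λ / (10 * w ^ 2)) * s ^ 2)) :=
      (integrable_exp_neg_mul_sq hb).const_mul _
    calc ‖∫ s in (-h)..h, (g s - G₀ - odd s) * E s‖
        ≤ ∫ s in (-h)..h, 16000 * M / Λ * Real.exp (-(Λ / (10 * w ^ 2)) * s ^ 2) := by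
          refine intervalIntegral.norm_integral_le_of_norm_le (by linarith)
            (ae_of_all _ fun s hs => ?_) hint.intervalIntegrable
          have hs : s ∈ Icc (-h) h := ⟨hs.1.le, hs.2⟩
          have ht := norm_taylor_le hGd hGM (hmem s hs)
          rw [add_sub_cancel_left] at ht
          set r := ‖ζ s‖ / w with hr
          have hζr : ‖ζ s‖ = r * w := by rw [hr]; field_simp
          have hr2 : r ^ 2 = 2 * s ^ 2 / w ^ 2 := by
            rw [hr, div_pow, hζn, mul_pow, Real.sq_sqrt zero_le_two, sq_abs]
          have hr7 : r ≤ 1 / 7 := by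
            rw [hr, div_le_iff₀ hw]; linarith [hζ7 s hs]
          have hp := norm_saddle_pointwise_le (G := amplitude α β γ (w + ζ s)) (G₀ := G₀)
            (D := D * ζ s) (Q := phaseRemainder T k w (ζ s)) (C := C₃ * ζ s ^ 3) (M := M)
            (Λ := Λ) (r := r) (by positivity) hr7 hΛ (hGM _ (hmem s hs))
            (hGM _ (mem_ball_self (by positivity)))
            (ht.1.trans (le_of_eq (by rw [hζr]; field_simp; ring)))
            (ht.2.trans (le_of_eq (by rw [hζr]; field_simp; ring)))
            (norm_phaseRemainder_le hT hw ‹_› (hζ7 s hs))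
            (norm_phaseRemainder_sub_cubic_le hT hw ‹_› ((hζ7 s hs).trans (by linarith)))
          have e1 : Λ * r ^ 2 / 20 = Λ / (10 * w ^ 2) * s ^ 2 := by
            rw [hr2]; field_simp; ring
          have e2 : Real.exp (-q * s ^ 2) ≤ Real.exp (-(Λ * r ^ 2 / 2)) := by
            refine Real.exp_le_exp.mpr ?_
            have e3 : Λ * r ^ 2 / 2 = Λ / w ^ 2 * s ^ 2 := by rw [hr2]; field_simp
            rw [e3]
            nlinarith [mul_le_mul_of_nonneg_right hq (sq_nonneg s)]
          rw [e1, ← neg_mul] at hp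
          rw [norm_mul, hE, Complex.norm_of_nonneg (Real.exp_pos _).le]
          exact (mul_le_mul_of_nonneg_left e2 (norm_nonneg _)).trans hp
      _ ≤ ∫ s, 16000 * M / Λ * Real.exp (-(Λ / (10 * w ^ 2)) * s ^ 2) := by
          rw [intervalIntegral.integral_of_le (by linarith)]
          refine setIntegral_le_integral hint (Filter.Eventually.of_forall fun s => ?_)
          simp only [Pi.zero_apply]
          positivity
      _ = 16000 * M / Λ * √(Real.pi / (Λ / (10 * w ^ 2))) := by
          rw [integral_const_mul, integral_gaussian]
      _ ≤ 16000 * M / Λ * (6 * w / √Λ) := by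
          gcongr
          rw [Real.sqrt_le_left (by positivity), div_pow, Real.sq_sqrt hΛ.le, div_le_div_iff₀ hb hΛ]
          have : Real.pi ≤ 3.6 := by linarith [Real.pi_lt_d2]
          have e : (6 * w) ^ 2 * (Λ / (10 * w ^ 2)) = 3.6 * Λ := by field_simp; norm_num
          rw [e]; gcongr
  -- Completing the Gaussian to the line: with `h = w/10` and `Q = Λ/w²`, `2/(Qh²) = 200/Λ` has the
  -- order of the Taylor error.
  have htail : ‖G₀ * (∫ s in (-h)..h, E s) - G₀ * (√(Real.pi / q) : ℝ)‖ ≤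
      M * (200 / Λ * (3 * w / √Λ)) := by
    have e : ∫ s in (-h)..h, E s = ((∫ s in (-h)..h, Real.exp (-q * s ^ 2) : ℝ) : ℂ) :=
      intervalIntegral.integral_ofReal
    rw [← mul_sub, norm_mul, e, ← Complex.ofReal_sub, Complex.norm_real, Real.norm_eq_abs,
      abs_sub_comm]
    refine mul_le_mul (hGM _ (mem_ball_self (by positivity)))
      ((gaussian_tail_le (by positivity) hq hh0).trans ?_) (abs_nonneg _) hM
    have e1 : 2 / (Λ / w ^ 2 * h ^ 2) = 200 / Λ := by rw [hh]; field_simp; norm_num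
    rw [e1]
    gcongr
    rw [Real.sqrt_le_left (by positivity), div_pow, Real.sq_sqrt hΛ.le,
      div_le_div_iff₀ (by positivity) hΛ]
    have e : (3 * w) ^ 2 * (Λ / w ^ 2 / 2) = 4.5 * Λ := by field_simp; norm_num
    rw [e]
    gcongr
    linarith [Real.pi_lt_four]
  have hrew : (1 + Complex.I) * (∫ s in (-h)..h,
        holIntegrand α β γ T k (w + s * (1 + Complex.I))) -
      (1 + Complex.I) * (holIntegrand α β γ T k w * (√(Real.pi / q) : ℝ)) =
      (1 + Complex.I) * (Complex.exp (Complex.I * phase T k w) *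
        ((∫ s in (-h)..h, (g s - G₀ - odd s) * E s) +
          (G₀ * (∫ s in (-h)..h, E s) - G₀ * (√(Real.pi / q) : ℝ)))) := by
    have e1 : ∫ s in (-h)..h, holIntegrand α β γ T k (w + s * (1 + Complex.I)) =
        Complex.exp (Complex.I * phase T k w) * ∫ s in (-h)..h, g s * E s := by
      rw [← intervalIntegral.integral_const_mul]
      exact intervalIntegral.integral_congr fun s _ => holIntegrand_saddle α β γ T k w s
    rw [e1, ← hsplit, holIntegrand]
    ring
  have hphase : ‖Complex.exp (Complex.I * phase T k w)‖ = 1 := by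
    have : phase T k w = ((T * Real.log ((1 + w) / w) + 2 * Real.pi * k * w : ℝ) : ℂ) := by
      rw [phase, logRatio_ofReal hw]; push_cast; ring
    rw [this, mul_comm, Complex.norm_exp_ofReal_mul_I]
  have hI : ‖(1 + Complex.I : ℂ)‖ ≤ 10 / 7 := by
    have := norm_smul_one_add_I 1
    simp only [Complex.ofReal_one, one_mul, abs_one, mul_one] at this
    rw [this]; exact hsqrt2
  rw [hrew, norm_mul, norm_mul, hphase, one_mul]
  calc _ ≤ 10 / 7 * (16000 * M / Λ * (6 * w / √Λ) + M * (200 / Λ * (3 * w / √Λ))) :=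
        mul_le_mul hI ((norm_add_le _ _).trans (add_le_add hmain htail)) (norm_nonneg _)
          (by norm_num)
    _ = 138000 * M * (w / (Λ * √Λ)) := by field_simp; ring
    _ ≤ _ := by gcongr; norm_num

end FirstIntegral

/-! ### Identification of the main term -/

namespace FirstIntegral

section SaddlePoint

variable {T k : ℝ}

lemma U_sq (hT : 0 < T) (hk : 0 < k) : U T k ^ 2 = T / (2 * Real.pi * k) + 1 / 4 :=
  Real.sq_sqrt (by positivity)

lemma half_lt_U (hT : 0 < T) (hk : 0 < k) : 1 / 2 < U T k := by
  refine Real.lt_sqrt_of_sq_lt ?_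
  have : 0 < T / (2 * Real.pi * k) := by positivity
  linarith

lemma saddle_eq (hT : 0 < T) (hk : 0 < k) :
    2 * Real.pi * k * ((U T k - 1 / 2) * (1 + (U T k - 1 / 2))) = T := by
  have e : (U T k - 1 / 2) * (1 + (U T k - 1 / 2)) = T / (2 * Real.pi * k) := by
    linear_combination U_sq hT hk
  rw [e]
  field_simp

/-- With `x² = 1/(4w(1+w))` one has `√(1+x²) = (2w+1)x`, so `exp(2 arsinh x) = (2w+2)²x² = (1+w)/w`.
-/
lemma log_ratio_eq_arsinh {w : ℝ} (hw : 0 < w) (hk : 0 < k)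
    (hs : 2 * Real.pi * k * (w * (1 + w)) = T) :
    Real.log ((1 + w) / w) = 2 * Real.arsinh √(Real.pi * k / (2 * T)) := by
  set x := √(Real.pi * k / (2 * T)) with hx
  have hx2 : x ^ 2 = 1 / (4 * (w * (1 + w))) := by
    rw [hx, Real.sq_sqrt (by rw [← hs]; positivity), ← hs]
    field_simp
    norm_num
  have h1 : √(1 + x ^ 2) = (2 * w + 1) * x := by
    have e : 1 + x ^ 2 = ((2 * w + 1) * x) ^ 2 := by
      rw [mul_pow, hx2]; field_simp; ring
    rw [e, Real.sqrt_sq (by positivity)]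
  have h2 : Real.exp (2 * Real.arsinh x) = (1 + w) / w := by
    rw [two_mul, Real.exp_add, Real.exp_arsinh, h1,
      show (x + (2 * w + 1) * x) * (x + (2 * w + 1) * x) = (2 * w + 2) ^ 2 * x ^ 2 by ring, hx2]
    field_simp
    ring
  rw [← h2, Real.log_exp]

/-- Fourth powers of the two nonnegative sides are compared, which removes the quarter exponents;
the curvature is `8π²k²U/T`. -/
lemma sqrt_curvature_eq (hT : 0 < T) (hk : 0 < k) :
    √2 * √(Real.pi / curvature T (U T k - 1 / 2)) =
      2 ^ (-(1 / 2) : ℝ) * k ^ (-(3 / 4) : ℝ) * (T / (2 * Real.pi)) ^ (1 / 4 : ℝ) *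
      (1 + k * Real.pi / (2 * T)) ^ (-(1 / 4) : ℝ) := by
  have hw : 0 < U T k - 1 / 2 := by linarith [half_lt_U hT hk]
  have hs := saddle_eq hT hk
  have hU2 := U_sq hT hk
  have hU0 : 0 < U T k := by linarith
  have hq : curvature T (U T k - 1 / 2) = 8 * Real.pi ^ 2 * k ^ 2 * U T k / T := by
    set w := U T k - 1 / 2 with hwdef
    have hU : U T k = w + 1 / 2 := by rw [hwdef]; ring
    rw [curvature, hU]
    have e : 8 * Real.pi ^ 2 * k ^ 2 = 2 * (T / (w * (1 + w))) ^ 2 := by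
      rw [← hs]; field_simp; norm_num
    rw [e]
    field_simp
    ring
  refine (pow_left_inj₀ (by positivity) (by positivity) (four_ne_zero)).mp ?_
  have p4 : ∀ {x : ℝ} (e : ℝ), 0 < x → (x ^ e) ^ 4 = x ^ (e * 4) := fun e hx => by
    rw [← Real.rpow_natCast, ← Real.rpow_mul hx.le]; norm_num
  have hb : 0 < 1 + k * Real.pi / (2 * T) := by positivity
  rw [mul_pow, mul_pow, mul_pow, mul_pow, p4 _ two_pos, p4 _ hk, p4 _ (by positivity), p4 _ hb,
    show (√2) ^ 4 = ((√2) ^ 2) ^ 2 by ring, Real.sq_sqrt zero_le_two,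
    show √(Real.pi / curvature T (U T k - 1 / 2)) ^ 4 =
      (√(Real.pi / curvature T (U T k - 1 / 2)) ^ 2) ^ 2 by ring,
    Real.sq_sqrt (by rw [hq]; positivity), hq]
  norm_num only
  rw [Real.rpow_one, Real.rpow_neg hk.le, Real.rpow_neg hb.le, Real.rpow_one, show k ^ (3 : ℝ) = k ^ 3 by
      exact_mod_cast Real.rpow_natCast k 3]
  have e : (Real.pi / (8 * Real.pi ^ 2 * k ^ 2 * U T k / T)) ^ 2 =
      T ^ 2 / (64 * Real.pi ^ 2 * k ^ 4 * U T k ^ 2) := by field_simp; norm_num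
  rw [e, hU2]
  field_simp
  ring

/-- The leading part of the contribution of the saddle point is the main term. -/
lemma mainTerm_eq (α β γ : ℝ) (hT : 0 < T) (hk : 0 < k) :
    (1 + Complex.I) * (holIntegrand α β γ T k ((U T k - 1 / 2 : ℝ) : ℂ) *
      (√(Real.pi / curvature T (U T k - 1 / 2)) : ℝ)) = mainTerm α β γ k T := by
  have hw : 0 < U T k - 1 / 2 := by linarith [half_lt_U hT hk]
  have hs := saddle_eq hT hk
  have hlog := log_ratio_eq_arsinh hw hk hs
  have hcurv := sqrt_curvature_eq hT hk
  have hars : 0 ≤ Real.arsinh √(Real.pi * k / (2 * T)) :=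
    Real.arsinh_nonneg_iff.mpr (Real.sqrt_nonneg _)
  -- The crossing direction supplies the phase `π/4` and the factor `√2`.
  have hI : (1 + Complex.I : ℂ) = (√2 : ℝ) * Complex.exp (Complex.I * (Real.pi / 4 : ℝ)) := by
    rw [mul_comm Complex.I, Complex.exp_mul_I, ← Complex.ofReal_cos, ← Complex.ofReal_sin,
      Real.cos_pi_div_four, Real.sin_pi_div_four]
    have h2 : ((√2 : ℝ) : ℂ) * (√2 : ℝ) = 2 := by
      rw [← Complex.ofReal_mul, Real.mul_self_sqrt zero_le_two]; norm_num
    push_cast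
    linear_combination (-(1 + Complex.I) / 2) * h2
  have hsq : √((Real.pi * k) ^ 2 + 2 * Real.pi * k * T) = 2 * Real.pi * k * U T k := by
    have e : (Real.pi * k) ^ 2 + 2 * Real.pi * k * T = (2 * Real.pi * k * U T k) ^ 2 := by
      rw [mul_pow _ (U T k), U_sq hT hk]; field_simp; ring
    have : 0 < U T k := by linarith
    rw [e, Real.sqrt_sq (by positivity)]
  have hamp : (2 : ℝ) ^ (-(1 / 2) - γ) * k ^ (-(3 / 4) : ℝ) * (T / (2 * Real.pi)) ^ (1 / 4 : ℝ) *
      (1 + k * Real.pi / (2 * T)) ^ (-(1 / 4) : ℝ) *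
      (U T k - 1 / 2) ^ (-α) * (U T k + 1 / 2) ^ (-β) *
      (Real.arsinh √(Real.pi * k / (2 * T))) ^ (-γ) =
      √2 * √(Real.pi / curvature T (U T k - 1 / 2)) * ((U T k - 1 / 2) ^ (-α) *
        (1 + (U T k - 1 / 2)) ^ (-β) *
        (Real.log ((1 + (U T k - 1 / 2)) / (U T k - 1 / 2))) ^ (-γ)) := by
    rw [hcurv, hlog, Real.mul_rpow two_pos.le hars, sub_eq_add_neg (-(1 / 2) : ℝ) γ,
      Real.rpow_add two_pos, show 1 + (U T k - 1 / 2) = U T k + 1 / 2 by ring]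
    ring
  have hph : 2 * T * Real.arsinh √(Real.pi * k / (2 * T)) +
      √((Real.pi * k) ^ 2 + 2 * Real.pi * k * T) - Real.pi * k + Real.pi / 4 =
      Real.pi / 4 + (T * Real.log ((1 + (U T k - 1 / 2)) / (U T k - 1 / 2)) +
        2 * Real.pi * k * (U T k - 1 / 2)) := by
    rw [hsq, hlog]; ring
  have hexp : ∀ x y : ℝ, Complex.exp (Complex.I * ((x + y : ℝ) : ℂ)) =
      Complex.exp (Complex.I * (x : ℝ)) * Complex.exp (Complex.I * (y : ℝ)) := fun x y => by
    rw [Complex.ofReal_add, mul_add, Complex.exp_add]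
  rw [holIntegrand_ofReal α β γ T k hw, mainTerm, integrand, hamp, hph, hI,
    hexp (Real.pi / 4), Complex.ofReal_mul (√2 * _), Complex.ofReal_mul √2]
  ring

end SaddlePoint

end FirstIntegral

/-! ### Assembling the contours -/

namespace FirstIntegral

open Set MeasureTheory

variable {α β γ : ℝ}

/-- The bound for the end-point and ray contributions to both integrals. -/
noncomputable def boundaryError (α β γ a b k T : ℝ) : ℝ :=
  (3 / 2) ^ γ * (a ^ (-α) * (1 + a) ^ (γ - β)) / (T / (5 * a)) +
  (3 / 2) ^ γ * (b ^ (-α) * (1 + b) ^ (γ - β)) / (5 * k) +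
  101 / 100 * ((3 / 2) ^ γ * ∫ y in a..b, majorant α β γ T k y)

/-- The bound for the contribution of the saddle point. -/
noncomputable def saddleError (α β γ k T : ℝ) : ℝ :=
  200000 * (2 ^ (α + β) * (3 / 2) ^ γ * ((U T k - 1 / 2) ^ (-α) *
    (1 + (U T k - 1 / 2)) ^ (γ - β))) *
    ((U T k - 1 / 2) / (T / (1 + (U T k - 1 / 2)) * √(T / (1 + (U T k - 1 / 2)))))

lemma integral_integrand_eq {a b T κ : ℝ} (ha : 0 < a) (hb : 0 < b) :
    ∫ y in a..b, integrand α β γ T κ y = ∫ y in a..b, holIntegrand α β γ T κ (y : ℂ) :=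
  intervalIntegral.integral_congr fun _ hy =>
    (holIntegrand_ofReal α β γ T κ ((lt_min ha hb).trans_le hy.1)).symm

theorem norm_integral_neg_le (hα : 0 < α) (hβ : 0 < β) (hγ : 0 < γ) {a b k T : ℝ} (ha : 0 < a)
    (ha1 : a ≤ 1) (hab : a ≤ b) (hk : 1 ≤ k) (hT : 0 < T) (hb : T ≤ b) :
    ‖∫ y in a..b, integrand α β γ T (-k) y‖ ≤ boundaryError α β γ a b k T := by
  have hb0 : 0 < b := hT.trans_le hb
  have hk0 : 0 < k := by linarith
  rw [integral_integrand_eq ha hb0, contour_lower (differentiableOn_holIntegrand α β γ T (-k))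
    (ε := 1 / 9) ha hb0]
  have h1 := norm_vertical_left_le (κ := -k) hα hβ hγ hT ha ha1 (by
    have : 0 < T / (4 * a) := by positivity
    have : 0 < 2 * Real.pi * k := by positivity
    linarith)
  have h2 := norm_vertical_right_lower_le hα hβ hγ hk hT hb
  have h3 := norm_ray_integral_le hα hβ hγ (T := T) (k := k) (κ := -k)
    (v := 1 - ((1 / 9 : ℝ) : ℂ) * Complex.I) ha hab (by simp) (by
      simp [abs_of_pos, -one_div, -Complex.ofReal_div])
    fun y hy => decay_ray_lower_neg hT hk0 (ha.trans_le hy.1)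
  refine (norm_sub_le _ _).trans ((add_le_add ((norm_add_le _ _).trans (add_le_add h1 h3))
    h2).trans (le_of_eq ?_))
  rw [boundaryError]; ring

theorem norm_integral_sub_mainTerm_le (hα : 0 < α) (hβ : 0 < β) (hγ : 0 < γ) {a b k T : ℝ}
    (ha : 0 < a) (ha1 : a ≤ 1) (ha2 : a ≤ T / (8 * Real.pi * k)) (hk : 1 ≤ k) (hT : 0 < T)
    (hb : T ≤ b) :
    ‖(∫ y in a..b, integrand α β γ T k y) - mainTerm α β γ k T‖ ≤
      boundaryError α β γ a b k T + saddleError α β γ k T := by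
  have hb0 : 0 < b := hT.trans_le hb
  have hk0 : 0 < k := by linarith
  have hw : 0 < U T k - 1 / 2 := by linarith [half_lt_U hT hk0]
  have hs := saddle_eq hT hk0
  rw [← mainTerm_eq α β γ hT hk0, saddleError]
  set w := U T k - 1 / 2
  -- The left ray has to start before the saddle segment. For `w ≤ 2`, `a ≤ T/(8πk) = w(1+w)/4 ≤
  -- (3/4)w`; otherwise `a ≤ 1` suffices.
  have haw : a ≤ 9 / 10 * w := by
    rcases le_or_gt w 2 with h | h
    · have e : T / (8 * Real.pi * k) = w * (1 + w) / 4 := by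
        rw [← hs]; field_simp; norm_num
      rw [e] at ha2
      nlinarith
    · linarith
  have hwb : 11 / 10 * w ≤ b := by
    have h1 : 6 * w ≤ T := by
      rw [← hs]
      have h6 : 6 ≤ 2 * Real.pi * k := by nlinarith [Real.pi_gt_three]
      have hw1 : w ≤ w * (1 + w) := by nlinarith
      exact mul_le_mul h6 hw1 hw.le (by linarith)
    linarith
  rw [integral_integrand_eq ha hb0, contour_saddle (differentiableOn_holIntegrand α β γ T k)
    ha hb0 hw]
  have h1 := norm_vertical_left_le (κ := k) hα hβ hγ hT ha ha1 (by
    rw [le_div_iff₀ (by positivity)] at ha2 ⊢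
    linarith)
  have h2 := norm_vertical_right_upper_le hα hβ hγ hk hT hb
  have h3 := norm_ray_integral_le hα hβ hγ (T := T) (k := k) (κ := k)
    (v := 1 - ((1 / 9 : ℝ) : ℂ) * Complex.I) ha haw (by simp) (by
      simp [abs_of_pos, -one_div, -Complex.ofReal_div])
    fun y hy => decay_ray_lower hk0 hw hs (ha.trans_le hy.1) hy.2
  have h4 := norm_ray_integral_le hα hβ hγ (T := T) (k := k) (κ := k)
    (v := 1 + ((1 / 11 : ℝ) : ℂ) * Complex.I) (by positivity) hwb (by simp) (by
      simp [abs_of_pos, -one_div, -Complex.ofReal_div]; norm_num)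
    fun y hy => decay_ray_upper hk0 hw hs hy.1
  have h5 := norm_saddle_segment_le hα hβ hγ hT hw hs
  -- The gap over the saddle segment is filled in with a nonnegative majorant, so that
  -- `boundaryError` covers both integrals.
  have h6 : (∫ y in a..(9 / 10 * w), majorant α β γ T k y) +
      (∫ y in (11 / 10 * w)..b, majorant α β γ T k y) ≤ ∫ y in a..b, majorant α β γ T k y := by
    have p1 : 0 < 9 / 10 * w := by positivity
    have p2 : 0 < 11 / 10 * w := by positivity
    rw [← intervalIntegral.integral_add_adjacent_intervals
        (intervalIntegrable_majorant α β γ T k ha p1)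
        (intervalIntegrable_majorant α β γ T k p1 hb0),
      ← intervalIntegral.integral_add_adjacent_intervals
        (intervalIntegrable_majorant α β γ T k p1 p2)
        (intervalIntegrable_majorant α β γ T k p2 hb0)]
    have : 0 ≤ ∫ y in (9 / 10 * w)..(11 / 10 * w), majorant α β γ T k y :=
      intervalIntegral.integral_nonneg (by linarith) fun y hy =>
        majorant_nonneg α β γ T k (p1.trans_le hy.1)
    linarith
  have h7 := mul_le_mul_of_nonneg_left h6 (by positivity : (0:ℝ) ≤ (3 / 2) ^ γ)
  have reorder : ∀ A B C D E F : ℂ, A + B + C + D - E - F = (A + B) + (D - E) + (C - F) := by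
    intros; ring
  rw [reorder, boundaryError]
  refine (norm_add₃_le).trans ?_
  have n1 := (norm_add_le _ _).trans (add_le_add h1 h3)
  have n2 := (norm_sub_le _ _).trans (add_le_add h4 h2)
  rw [mul_add] at h7
  linarith

end FirstIntegral

/-! ### Boundary error against `U1`, `U2`, `U3`, `U41`, `U43` -/

namespace FirstIntegral

open Set MeasureTheory

variable {α β γ : ℝ}

/-- The factor common to all error terms. -/
noncomputable def commonFactor (α β γ : ℝ) : ℝ := 2 ^ (α + β - γ) * 3 ^ γ

lemma commonFactor_eq (α β γ : ℝ) : commonFactor α β γ = 2 ^ (α + β) * (3 / 2) ^ γ := by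
  rw [commonFactor, Real.rpow_sub two_pos, Real.div_rpow (by norm_num) two_pos.le]
  ring

lemma commonFactor_pos (α β γ : ℝ) : 0 < commonFactor α β γ := by
  rw [commonFactor]; positivity

/-- The sector bound on the rays needs only `(3/2)^γ`; giving away `2^(α+β)` there makes the factor
uniform. -/
lemma le_commonFactor (hα : 0 < α) (hβ : 0 < β) : (3 / 2) ^ γ ≤ commonFactor α β γ := by
  rw [commonFactor_eq]
  exact le_mul_of_one_le_left (by positivity)
    (Real.one_le_rpow one_le_two (by linarith))

lemma exp_neg_le_inv {x : ℝ} (hx : 0 < x) : Real.exp (-x) ≤ 1 / x := by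
  rw [Real.exp_neg, ← one_div]
  exact one_div_le_one_div_of_le hx (by linarith [Real.add_one_le_exp x])

/-- Bound for the near part of the majorant in the range `k ≤ A'' T`. -/
lemma near_le_U41 (hα1 : α < 1) {T k A : ℝ} (hA : 0 < A) (hT : 1 ≤ T) (hk : 1 ≤ k)
    (hkA : k ≤ A * T) :
    101 / 100 * (2 ^ |γ - β| * Real.exp (-(T / 400)) * (1 / (1 - α))) ≤
      U41 α β γ A * T ^ (1 / 2 * (γ - α - β) - 1 / 4) * k ^ (-(1 / 2) * (γ - α - β) - 5 / 4) := by
  have hT0 : 0 < T := by linarith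
  have hk0 : 0 < k := by linarith
  have h1α : 0 < 1 - α := by linarith
  set c := γ - α - β
  -- `n` is the exponent in `U41`, whose base is `76772.8 n`. Since `T ≤ 400 n exp(T/(400n))`, that
  -- base is large enough for `T^n exp(-T/400)`.
  set n := 1 / 2 * |c| + 3 / 2 with hn
  have hn0 : 0 < n := by positivity
  have hX : 1 ≤ A * T / k := by rw [one_le_div hk0]; exact hkA
  have hbase : 38386.4 * (|c| + 3) = 76772.8 * n := by rw [hn]; ring
  have hexp : T ^ n * Real.exp (-(T / 400)) ≤ (38386.4 * (|c| + 3)) ^ n := by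
    rw [hbase]
    have h1 : T ≤ 76772.8 * n * Real.exp (T / 400 / n) := by
      have h2 := Real.add_one_le_exp (T / 400 / n)
      have h3 : T = 400 * n * (T / 400 / n) := by field_simp
      have h4 : 0 < T / 400 / n := by positivity
      calc T = 400 * n * (T / 400 / n) := h3
        _ ≤ 76772.8 * n * Real.exp (T / 400 / n) := by
          gcongr
          · norm_num
          · linarith
    have h5 := Real.rpow_le_rpow hT0.le h1 hn0.le
    rw [Real.mul_rpow (by positivity) (Real.exp_pos _).le, ← Real.exp_mul,
      div_mul_cancel₀ _ hn0.ne'] at h5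
    calc T ^ n * Real.exp (-(T / 400))
        ≤ (76772.8 * n) ^ n * Real.exp (T / 400) * Real.exp (-(T / 400)) := by gcongr
      _ = (76772.8 * n) ^ n := by
          rw [mul_assoc, ← Real.exp_add, add_neg_cancel, Real.exp_zero, mul_one]
  have hpow : T ^ (-n) ≤ A ^ (5 / 4 : ℝ) * max 1 (A ^ (1 / 2 * c)) *
      (T ^ (1 / 2 * c - 1 / 4) * k ^ (-(1 / 2) * c - 5 / 4)) := by
    have e0 : ∀ e : ℝ, (A * T / k) ^ e = A ^ e * T ^ e * k ^ (-e) := fun e => by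
      rw [Real.div_rpow (by positivity) hk0.le, Real.mul_rpow hA.le hT0.le, Real.rpow_neg hk0.le]
      rfl
    -- The hypothesis `k ≤ AT` enters as `(AT/k)^e ≥ 1`, with `e = 5/4 + c/2` for `c ≥ 0` and `e =
    -- 5/4` otherwise; the two cases match the two entries of the maximum.
    rcases le_total 0 c with hc | hc
    · have h2 : 1 ≤ (A * T / k) ^ (5 / 4 + 1 / 2 * c : ℝ) :=
        Real.one_le_rpow hX (by positivity)
      rw [e0, Real.rpow_add hA] at h2
      have h3 : T ^ (1 / 2 * c - 1 / 4) = T ^ (5 / 4 + 1 / 2 * c) * T ^ (-(3 / 2) : ℝ) := by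
        rw [← Real.rpow_add hT0]; congr 1; ring
      have h4 : T ^ (-n) ≤ T ^ (-(3 / 2) : ℝ) :=
        Real.rpow_le_rpow_of_exponent_le hT (by rw [hn]; linarith [abs_nonneg c])
      have h5 : -(1 / 2) * c - 5 / 4 = -(5 / 4 + 1 / 2 * c) := by ring
      rw [h3, h5]
      calc T ^ (-n) ≤ 1 * T ^ (-(3 / 2) : ℝ) := by rw [one_mul]; exact h4
        _ ≤ A ^ (5 / 4 : ℝ) * A ^ (1 / 2 * c) * T ^ (5 / 4 + 1 / 2 * c) *
            k ^ (-(5 / 4 + 1 / 2 * c)) * T ^ (-(3 / 2) : ℝ) := by gcongr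
        _ = A ^ (5 / 4 : ℝ) * A ^ (1 / 2 * c) * (T ^ (5 / 4 + 1 / 2 * c) * T ^ (-(3 / 2) : ℝ) *
            k ^ (-(5 / 4 + 1 / 2 * c))) := by ring
        _ ≤ _ := by gcongr; exact le_max_right _ _
    · have h2 : 1 ≤ (A * T / k) ^ (5 / 4 : ℝ) := Real.one_le_rpow hX (by positivity)
      rw [e0] at h2
      have h3 : T ^ (1 / 2 * c - 1 / 4) = T ^ (5 / 4 : ℝ) * T ^ (-n) := by
        rw [← Real.rpow_add hT0]; congr 1; rw [hn, abs_of_nonpos hc]; ring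
      have h4 : k ^ (-(1 / 2) * c - 5 / 4) = k ^ (-(5 / 4) : ℝ) * k ^ (-(1 / 2) * c) := by
        rw [← Real.rpow_add hk0]; congr 1; ring
      have h5 : 1 ≤ k ^ (-(1 / 2) * c) := Real.one_le_rpow hk (by linarith)
      rw [h3, h4]
      calc T ^ (-n) = 1 * 1 * T ^ (-n) * 1 := by ring
        _ ≤ A ^ (5 / 4 : ℝ) * T ^ (5 / 4 : ℝ) * k ^ (-(5 / 4) : ℝ) * 1 * T ^ (-n) *
            k ^ (-(1 / 2) * c) := by
          gcongr
        _ = A ^ (5 / 4 : ℝ) * 1 * (T ^ (5 / 4 : ℝ) * T ^ (-n) *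
            (k ^ (-(5 / 4) : ℝ) * k ^ (-(1 / 2) * c))) := by ring
        _ ≤ _ := by gcongr; exact le_max_left _ _
  have hexp2 : Real.exp (-(T / 400)) ≤ T ^ (-n) * (38386.4 * (|c| + 3)) ^ n := by
    rw [Real.rpow_neg hT0.le, ← div_eq_inv_mul, le_div_iff₀ (by positivity), mul_comm]
    exact hexp
  have habs : |α - 1| = 1 - α := by rw [abs_sub_comm, abs_of_pos h1α]
  rw [U41, habs]
  calc 101 / 100 * (2 ^ |γ - β| * Real.exp (-(T / 400)) * (1 / (1 - α)))
      ≤ 1.02 * (2 ^ |γ - β| * (A ^ (5 / 4 : ℝ) * max 1 (A ^ (1 / 2 * c)) *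
      (T ^ (1 / 2 * c - 1 / 4) * k ^ (-(1 / 2) * c - 5 / 4)) * (38386.4 * (|c| + 3)) ^ n) *
        (1 / (1 - α))) := by
        refine mul_le_mul (by norm_num) ?_ (by positivity) (by norm_num)
        gcongr
        exact hexp2.trans (mul_le_mul_of_nonneg_right hpow (by positivity))
    _ = _ := by ring

/-- Bound for the near part of the majorant in the range `A' T ≤ k`. -/
lemma near_le_U43 (hα : 0 < α) (hα1 : α < 1) {T T₀ k A : ℝ} (hA : 0 < A) (hT₀ : 1 ≤ T₀)
    (hT : T₀ ≤ T) (hk : 1 ≤ k) :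
    101 / 100 * (2 ^ |γ - β| * Real.exp (-(T / 400)) * (200 * k ^ (α - 1) / (1 - α))) ≤
      U43 α β γ A T₀ * T ^ (-(1 / 2) - α) * k ^ (α - 1) := by
  have hT1 : 1 ≤ T := hT₀.trans hT
  have hT0 : 0 < T := by linarith
  have hk0 : 0 < k := by linarith
  have h1α : 0 < 1 - α := by linarith
  have habs : |α - 1| = 1 - α := by rw [abs_sub_comm, abs_of_pos h1α]
  set p := 1 / √T with hp
  have hsT : 1 ≤ √T := Real.one_le_sqrt.mpr hT1
  have hp0 : 0 < p := by positivity
  have hp1 : p ≤ 1 := by rw [hp, div_le_one (by positivity)]; exact hsT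
  -- In `U43` the factor `1/(1-α)` accompanies only `A^(1-α)`. AM-GM with weights `1-α` and `α`,
  -- arranged so that `A` cancels in the geometric mean, recovers `p/(1-α)` for every `A > 0`.
  have hamgm : p / (1 - α) ≤ A ^ (-α) * (A / (1 - α) + p) := by
    have h := Real.geom_mean_le_arith_mean2_weighted (w₁ := 1 - α) (w₂ := α)
      (p₁ := A ^ (-α) * (p / (1 - α))) (p₂ := A ^ (1 - α) / (1 - α)) h1α.le hα.le (by positivity)
      (by positivity) (by ring)
    have e1 : (A ^ (-α) * (p / (1 - α))) ^ (1 - α) * (A ^ (1 - α) / (1 - α)) ^ α =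
        p ^ (1 - α) / (1 - α) := by
      rw [Real.mul_rpow (by positivity) (by positivity), Real.div_rpow hp0.le h1α.le,
        Real.div_rpow (by positivity) h1α.le, ← Real.rpow_mul hA.le, ← Real.rpow_mul hA.le]
      have e2 : A ^ (-α * (1 - α)) * A ^ ((1 - α) * α) = 1 := by
        rw [← Real.rpow_add hA, show -α * (1 - α) + (1 - α) * α = 0 by ring, Real.rpow_zero]
      have e3 : (1 - α) ^ (1 - α) * (1 - α) ^ α = 1 - α := by
        rw [← Real.rpow_add h1α, sub_add_cancel, Real.rpow_one]
      calc _ = A ^ (-α * (1 - α)) * A ^ ((1 - α) * α) * p ^ (1 - α) /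
            ((1 - α) ^ (1 - α) * (1 - α) ^ α) := by field_simp
        _ = _ := by rw [e2, e3, one_mul]
    have e4 : A ^ (-α) * (A / (1 - α)) = A ^ (1 - α) / (1 - α) := by
      rw [sub_eq_neg_add, Real.rpow_add hA, Real.rpow_one]; ring
    have h2 : p ≤ p ^ (1 - α) := by
      calc p = p ^ (1 : ℝ) := (Real.rpow_one p).symm
        _ ≤ p ^ (1 - α) := Real.rpow_le_rpow_of_exponent_ge hp0 hp1 (by linarith)
    have h3 : α * (A ^ (1 - α) / (1 - α)) ≤ A ^ (1 - α) / (1 - α) :=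
      mul_le_of_le_one_left (by positivity) hα1.le
    have h4 : (1 - α) * (A ^ (-α) * (p / (1 - α))) = A ^ (-α) * p := by field_simp
    rw [e1, h4] at h
    rw [mul_add, e4]
    have h5 : p / (1 - α) ≤ p ^ (1 - α) / (1 - α) := by gcongr
    linarith
  have hpT₀ : p ≤ 1 / √T₀ := by
    rw [hp]
    exact one_div_le_one_div_of_le (Real.sqrt_pos.mpr (by linarith)) (Real.sqrt_le_sqrt hT)
  have hU : 2 ^ |γ - β| * (3.975 * 10 ^ 7 * (p / (1 - α))) ≤ U43 α β γ A T₀ := by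
    rw [U43, habs, mul_assoc (2 ^ |γ - β|)]
    refine mul_le_mul_of_nonneg_left ?_ (by positivity)
    calc 3.975 * 10 ^ 7 * (p / (1 - α))
        ≤ 3.975 * 10 ^ 7 * (A ^ (-α) * (A / (1 - α) + p)) := by gcongr
      _ = A ^ (-α) * (3.975 * 10 ^ 7 / (1 - α) * A + 3.975 * 10 ^ 7 * p) := by ring
      _ ≤ A ^ (-α) * (3.975 * 10 ^ 7 / (1 - α) * A + 1.63 * 10 ^ 10 * (1 / √T₀)) := by
          refine mul_le_mul_of_nonneg_left (add_le_add le_rfl ?_) (by positivity)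
          exact mul_le_mul (by norm_num) hpT₀ hp0.le (by norm_num)
      _ = _ := by ring
  -- From `exp(T/400) = exp(T/800 - 1)² e² ≥ 4(T/800)²`.
  have hexp : T ^ 2 * Real.exp (-(T / 400)) ≤ 160000 := by
    rw [Real.exp_neg, ← div_eq_mul_inv, div_le_iff₀ (Real.exp_pos _)]
    have h1 := Real.add_one_le_exp (T / 400 / 2)
    have h2 : Real.exp (T / 400) = Real.exp (T / 400 / 2 - 1) ^ 2 * Real.exp 1 ^ 2 := by
      rw [← mul_pow, ← Real.exp_add, ← Real.exp_nat_mul]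
      congr 1; push_cast; ring
    have h3 := Real.add_one_le_exp (T / 400 / 2 - 1)
    have h4 : (2 : ℝ) ≤ Real.exp 1 := by linarith [Real.add_one_le_exp (1 : ℝ)]
    have h5 : (T / 800) ^ 2 ≤ Real.exp (T / 400 / 2 - 1) ^ 2 :=
      pow_le_pow_left₀ (by positivity) (by linarith) 2
    have h6 : (2 : ℝ) ^ 2 ≤ Real.exp 1 ^ 2 := pow_le_pow_left₀ (by norm_num) h4 2
    have h7 := mul_le_mul h5 h6 (by norm_num) (by positivity)
    rw [← h2] at h7
    linarith
  have hTpow : T ^ (1 / 2 + α) ≤ T ^ 2 * p := by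
    have e : T ^ 2 * p = T ^ (3 / 2 : ℝ) := by
      rw [hp, Real.sqrt_eq_rpow, one_div, ← Real.rpow_neg hT0.le, ← Real.rpow_natCast,
        ← Real.rpow_add hT0]
      norm_num
    rw [e]
    exact Real.rpow_le_rpow_of_exponent_le hT1 (by linarith)
  have hkey : 202 * Real.exp (-(T / 400)) ≤ 3.975 * 10 ^ 7 * p * T ^ (-(1 / 2) - α) := by
    have e : T ^ (-(1 / 2) - α) = (T ^ (1 / 2 + α))⁻¹ := by
      rw [← Real.rpow_neg hT0.le]; congr 1; ring
    rw [e, ← div_eq_mul_inv, le_div_iff₀ (by positivity)]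
    calc 202 * Real.exp (-(T / 400)) * T ^ (1 / 2 + α)
        ≤ 202 * Real.exp (-(T / 400)) * (T ^ 2 * p) := by gcongr
      _ = 202 * (T ^ 2 * Real.exp (-(T / 400))) * p := by ring
      _ ≤ 202 * 160000 * p := by gcongr
      _ ≤ 3.975 * 10 ^ 7 * p := mul_le_mul_of_nonneg_right (by norm_num) hp0.le
  calc 101 / 100 * (2 ^ |γ - β| * Real.exp (-(T / 400)) * (200 * k ^ (α - 1) / (1 - α)))
      = 2 ^ |γ - β| * (202 * Real.exp (-(T / 400))) * (1 / (1 - α)) * k ^ (α - 1) := by ring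
    _ ≤ 2 ^ |γ - β| * (3.975 * 10 ^ 7 * p * T ^ (-(1 / 2) - α)) * (1 / (1 - α)) *
        k ^ (α - 1) := by gcongr
    _ = 2 ^ |γ - β| * (3.975 * 10 ^ 7 * (p / (1 - α))) * T ^ (-(1 / 2) - α) * k ^ (α - 1) := by
        ring
    _ ≤ _ := by gcongr

/-- All of the boundary error except the near part of the rays. -/
lemma boundaryError_le (hα : 0 < α) (hβ : 0 < β) {a b k T : ℝ} (ha : 0 < a)
    (ha1 : a ≤ 1) (hk : 1 ≤ k) (hT : 1 ≤ T) (hb : T ≤ b) :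
    boundaryError α β γ a b k T + commonFactor α β γ * 2 ^ |γ - β| *
        (2 * (39038 / |α - 1|)) * a ^ (1 - α) * T⁻¹ ≤
      commonError α β γ a b k T + commonFactor α β γ *
        (101 / 100 * ∫ y in a..1, majorant α β γ T k y) := by
  have hT0 : 0 < T := by linarith
  have hk0 : 0 < k := by linarith
  have hb1 : 1 ≤ b := hT.trans hb
  have hb0 : 0 < b := by linarith
  set N : ℝ := 2 ^ |γ - β| with hN
  have hN0 : 0 < N := by positivity
  have hD := le_commonFactor (γ := γ) hα hβ
  have hD0 := commonFactor_pos α β γ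
  have eU : ∀ r : ℝ, (2 : ℝ) ^ (|γ - β| + r + α + β - γ) * 3 ^ γ =
      2 ^ r * N * commonFactor α β γ := fun r => by
    rw [hN, commonFactor, show |γ - β| + r + α + β - γ = r + |γ - β| + (α + β - γ) by ring,
      Real.rpow_add two_pos, Real.rpow_add two_pos]
    ring
  have eU0 : (2 : ℝ) ^ (|γ - β| + α + β - γ) * 3 ^ γ = N * commonFactor α β γ := by
    have := eU 0
    rwa [add_zero, Real.rpow_zero, one_mul] at this
  have tA : (3 / 2) ^ γ * (a ^ (-α) * (1 + a) ^ (γ - β)) / (T / (5 * a)) ≤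
      commonFactor α β γ * N * 5 * a ^ (1 - α) * T⁻¹ := by
    have e : a ^ (1 - α) = a ^ (-α) * a := by
      rw [sub_eq_neg_add, Real.rpow_add ha, Real.rpow_one]
    calc (3 / 2) ^ γ * (a ^ (-α) * (1 + a) ^ (γ - β)) / (T / (5 * a))
        ≤ commonFactor α β γ * (N * a ^ (-α)) / (T / (5 * a)) := by
          gcongr ?_ / _
          exact mul_le_mul hD (weight_le_of_le_one ha ha1) (by positivity) hD0.le
      _ = _ := by rw [e]; field_simp
  have tB : (3 / 2) ^ γ * (b ^ (-α) * (1 + b) ^ (γ - β)) / (5 * k) ≤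
      U2 α β γ * b ^ (γ - α - β) * k⁻¹ := by
    have e : U2 α β γ = 2.962 * (N * commonFactor α β γ) := by rw [U2, mul_assoc, eU0]
    rw [e]
    calc (3 / 2) ^ γ * (b ^ (-α) * (1 + b) ^ (γ - β)) / (5 * k)
        ≤ commonFactor α β γ * (N * b ^ (γ - α - β)) / (5 * k) := by
          gcongr ?_ / _
          exact mul_le_mul hD (weight_le_of_one_le hb1) (by positivity) hD0.le
      _ = 0.2 * (N * commonFactor α β γ) * b ^ (γ - α - β) * k⁻¹ := by field_simp; norm_num
      _ ≤ _ := by gcongr; norm_num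
  -- `U1` is split: its first summand, at least `5/2`, pays for the end point `a`; the summand
  -- `39038/|α-1|` is reserved for the near part of the rays.
  have tU1 : commonFactor α β γ * N * 5 * a ^ (1 - α) * T⁻¹ + commonFactor α β γ * N *
      (2 * (39038 / |α - 1|)) * a ^ (1 - α) * T⁻¹ ≤ U1 α β γ a * a ^ (1 - α) * T⁻¹ := by
    have e : U1 α β γ a = 2 * N * commonFactor α β γ *
        (34.26 * (1 + a) / (3 - a) + 39038 / |α - 1|) := by
      rw [U1, eU, Real.rpow_one]
    have h5 : 5 / 2 ≤ 34.26 * (1 + a) / (3 - a) := by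
      rw [le_div_iff₀ (by linarith)]; linarith
    rw [e]
    calc _ = 2 * N * commonFactor α β γ * (5 / 2 + 39038 / |α - 1|) * a ^ (1 - α) * T⁻¹ := by
          ring
      _ ≤ _ := by gcongr
  have tM : 101 / 100 * ((3 / 2) ^ γ * ∫ y in (1 : ℝ)..T, majorant α β γ T k y) +
      101 / 100 * ((3 / 2) ^ γ * ∫ y in T..b, majorant α β γ T k y) ≤ U3 α β γ b k T := by
    rw [U3, eU0]
    have hδ := delta_nonneg α β γ hT
    set Mx := max (b ^ (γ - α - β)) (T ^ (γ - α - β))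
    have hMx : 0 ≤ Mx := le_max_of_le_left (by positivity)
    have m1 : 101 / 100 * ((3 / 2) ^ γ * ∫ y in (1 : ℝ)..T, majorant α β γ T k y) ≤
        N * commonFactor α β γ * (1.02 * delta α β γ T * Real.exp (-(9.58 / 10 ^ 6 * √(T * k)))) := by
      calc _ ≤ 101 / 100 * (commonFactor α β γ *
              (N * delta α β γ T * Real.exp (-(√(T * k) / 200)))) := by
            refine mul_le_mul_of_nonneg_left ?_ (by norm_num)
            exact mul_le_mul hD (integral_majorant_middle_le hT hk)
              (intervalIntegral.integral_nonneg hT fun y hy =>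
                majorant_nonneg α β γ T k (by linarith [hy.1])) hD0.le
        _ ≤ 1.02 * (commonFactor α β γ *
              (N * delta α β γ T * Real.exp (-(9.58 / 10 ^ 6 * √(T * k))))) := by
            have := Real.sqrt_nonneg (T * k)
            refine mul_le_mul (by norm_num) ?_ (by positivity) (by norm_num)
            gcongr
            linarith
        _ = _ := by ring
    have m2 : 101 / 100 * ((3 / 2) ^ γ * ∫ y in T..b, majorant α β γ T k y) ≤
        N * commonFactor α β γ * (212232.3 / k * Mx * Real.exp (-(4.79 / 10 ^ 6 * (T * k)))) := by
      have hTk : 0 < T * k := by positivity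
      calc _ ≤ 101 / 100 * (commonFactor α β γ *
              (N * Mx * (200 / k * Real.exp (-(T * k / 200))))) := by
            refine mul_le_mul_of_nonneg_left ?_ (by norm_num)
            exact mul_le_mul hD (integral_majorant_far_le hT hk hb)
              (intervalIntegral.integral_nonneg hb fun y hy =>
                majorant_nonneg α β γ T k (by linarith [hy.1])) hD0.le
        _ = N * commonFactor α β γ * (202 / k * Mx * Real.exp (-(T * k / 200))) := by ring
        _ ≤ _ := by
            gcongr
            · norm_num
            · linarith
    rw [mul_add]
    exact add_le_add m1 m2
  have hsplit : ∫ y in a..b, majorant α β γ T k y = (∫ y in a..1, majorant α β γ T k y) +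
      (∫ y in (1 : ℝ)..T, majorant α β γ T k y) + ∫ y in T..b, majorant α β γ T k y := by
    rw [intervalIntegral.integral_add_adjacent_intervals
        (intervalIntegrable_majorant α β γ T k ha one_pos)
        (intervalIntegrable_majorant α β γ T k one_pos hT0),
      intervalIntegral.integral_add_adjacent_intervals
        (intervalIntegrable_majorant α β γ T k ha hT0)
        (intervalIntegrable_majorant α β γ T k hT0 hb0)]
  have tN : 101 / 100 * ((3 / 2) ^ γ * ∫ y in a..1, majorant α β γ T k y) ≤
      commonFactor α β γ * (101 / 100 * ∫ y in a..1, majorant α β γ T k y) := by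
    have h0 : 0 ≤ ∫ y in a..1, majorant α β γ T k y :=
      intervalIntegral.integral_nonneg ha1 fun y hy =>
        majorant_nonneg α β γ T k (ha.trans_le hy.1)
    nlinarith [mul_le_mul_of_nonneg_right hD h0]
  rw [boundaryError, commonError, hsplit, mul_add, mul_add, mul_add, mul_add]
  linarith

/-- For `α > 1` the integral concentrates at `a`; with `exp(-T/400) ≤ 400/T` it fits into the
reserved part of `U1`. -/
lemma near_le_of_one_lt (hα1 : 1 < α) {a k T : ℝ} (ha : 0 < a) (ha1 : a ≤ 1) (hk : 1 ≤ k)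
    (hT : 1 ≤ T) :
    101 / 100 * (∫ y in a..1, majorant α β γ T k y) ≤
      2 ^ |γ - β| * (2 * (39038 / |α - 1|)) * a ^ (1 - α) * T⁻¹ := by
  have hT0 : 0 < T := by linarith
  have h1 : 0 < α - 1 := by linarith
  have he : Real.exp (-(T / 400)) ≤ 400 * T⁻¹ := by
    refine (exp_neg_le_inv (by positivity)).trans (le_of_eq ?_)
    field_simp
  rw [abs_of_pos h1]
  calc 101 / 100 * (∫ y in a..1, majorant α β γ T k y)
      ≤ 101 / 100 * (2 ^ |γ - β| * (400 * T⁻¹) * (a ^ (1 - α) / (α - 1))) := by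
        gcongr
        refine (integral_majorant_near_le_of_one_lt hα1 hT0 (by linarith) ha ha1).trans ?_
        gcongr
    _ = 2 ^ |γ - β| * (404 / (α - 1)) * a ^ (1 - α) * T⁻¹ := by ring
    _ ≤ _ := by
        gcongr
        rw [mul_div_assoc']
        gcongr
        norm_num

lemma U41_nonneg (α β γ : ℝ) {A : ℝ} (hA : 0 < A) : 0 ≤ U41 α β γ A := by
  rw [U41]
  have : (0 : ℝ) ≤ max 1 (A ^ (1 / 2 * (γ - α - β))) := le_max_of_le_left zero_le_one
  positivity

lemma U43_nonneg (α β γ : ℝ) {A T₀ : ℝ} (hA : 0 < A) : 0 ≤ U43 α β γ A T₀ := by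
  rw [U43]; positivity

/-- For `α < 1` the near part goes into `U41` and the reserved part of `U1` is dropped; for `α > 1`
the roles are exchanged. -/
lemma boundaryError_le_small (hα : 0 < α) (hα1 : α ≠ 1) (hβ : 0 < β) {a b k T A : ℝ} (ha : 0 < a)
    (ha1 : a ≤ 1) (hk : 1 ≤ k) (hT : 1 ≤ T) (hb : T ≤ b) (hA : 0 < A) (hkA : k ≤ A * T) :
    boundaryError α β γ a b k T ≤ commonError α β γ a b k T + U4hatSmall α β γ A k T := by
  have hT0 : 0 < T := by linarith
  have hk0 : 0 < k := by linarith
  have h := boundaryError_le (γ := γ) hα hβ ha ha1 hk hT hb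
  have hD0 := commonFactor_pos α β γ
  have e : U4hatSmall α β γ A k T = commonFactor α β γ * (U41 α β γ A *
      T ^ (1 / 2 * (γ - α - β) - 1 / 4) * k ^ (-(1 / 2) * (γ - α - β) - 5 / 4)) := by
    rw [U4hatSmall, commonFactor]; ring
  rcases lt_or_gt_of_ne hα1 with h1 | h1
  · have h2 := mul_le_mul_of_nonneg_left ((mul_le_mul_of_nonneg_left
      (integral_majorant_near_le_of_lt_one (β := β) (γ := γ) h1 hT0 hk0 ha ha1)
      (by norm_num : (0:ℝ) ≤ 101 / 100)).trans (near_le_U41 h1 hA hT hk hkA)) hD0.le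
    have h3 : 0 ≤ commonFactor α β γ * 2 ^ |γ - β| * (2 * (39038 / |α - 1|)) * a ^ (1 - α) *
      T⁻¹ := by positivity
    rw [e]; linarith
  · have h2 := mul_le_mul_of_nonneg_left (near_le_of_one_lt (β := β) (γ := γ) h1 ha ha1 hk hT)
      hD0.le
    have h3 : 0 ≤ commonFactor α β γ * (U41 α β γ A *
      T ^ (1 / 2 * (γ - α - β) - 1 / 4) * k ^ (-(1 / 2) * (γ - α - β) - 5 / 4)) := by
      have := U41_nonneg α β γ hA
      positivity
    rw [e]; linarith

/-- The same alternative with `U43`. The near bound is uniform in `A`, so `k ≥ A'T` matters only for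
the saddle term. -/
lemma boundaryError_le_large (hα : 0 < α) (hα1 : α ≠ 1) (hβ : 0 < β) {a b k T T₀ A : ℝ}
    (ha : 0 < a) (ha1 : a ≤ 1) (hk : 1 ≤ k) (hT₀ : 1 ≤ T₀) (hT : T₀ ≤ T) (hb : T ≤ b)
    (hA : 0 < A) :
    boundaryError α β γ a b k T ≤ commonError α β γ a b k T + U4hatLarge α β γ A T₀ k T := by
  have hT1 : 1 ≤ T := hT₀.trans hT
  have hT0 : 0 < T := by linarith
  have hk0 : 0 < k := by linarith
  have h := boundaryError_le (γ := γ) hα hβ ha ha1 hk hT1 hb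
  have hD0 := commonFactor_pos α β γ
  have e : U4hatLarge α β γ A T₀ k T = commonFactor α β γ * (U43 α β γ A T₀ *
      T ^ (-(1 / 2) - α) * k ^ (α - 1)) := by
    rw [U4hatLarge, commonFactor]; ring
  rcases lt_or_gt_of_ne hα1 with h1 | h1
  · have h2 := mul_le_mul_of_nonneg_left ((mul_le_mul_of_nonneg_left
      (integral_majorant_near_le_k (β := β) (γ := γ) h1 hα hT0 hk0 ha ha1)
      (by norm_num : (0:ℝ) ≤ 101 / 100)).trans (near_le_U43 hα h1 hA hT₀ hT hk)) hD0.le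
    have h3 : 0 ≤ commonFactor α β γ * 2 ^ |γ - β| * (2 * (39038 / |α - 1|)) * a ^ (1 - α) *
      T⁻¹ := by positivity
    rw [e]; linarith
  · have h2 := mul_le_mul_of_nonneg_left (near_le_of_one_lt (β := β) (γ := γ) h1 ha ha1 hk hT1)
      hD0.le
    have h3 : 0 ≤ commonFactor α β γ * (U43 α β γ A T₀ *
      T ^ (-(1 / 2) - α) * k ^ (α - 1)) := by
      have := U43_nonneg α β γ (T₀ := T₀) hA
      positivity
    rw [e]; linarith

end FirstIntegral

/-! ### Saddle error against `U42` and `U44` -/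

namespace FirstIntegral

variable {α β γ : ℝ}

lemma eta_pos {A : ℝ} (hA : 0 < A) : 0 < eta A := by
  have := half_lt_U one_pos hA
  rw [eta]; linarith

/-- The saddle equation for `T = 1`. The bounds and monotonicity statements for `η` are read off
from this quadratic. -/
lemma eta_eq {A : ℝ} (hA : 0 < A) : eta A * (1 + eta A) = 1 / (2 * Real.pi * A) := by
  have := saddle_eq one_pos hA
  rw [eta, eq_div_iff (by positivity)]
  linarith

/-- The saddle depends only on `k/T`, so the two ranges of `k` become an upper and a lower bound for
the argument of `η`. -/
lemma saddle_point_eq_eta {T k : ℝ} (hT : 0 < T) : U T k - 1 / 2 = eta (k / T) := by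
  rw [eta, U, U]
  congr 3
  field_simp

lemma eta_le_eta {x A : ℝ} (hx : 0 < x) (hxA : x ≤ A) : eta A ≤ eta x := by
  have hA := hx.trans_le hxA
  have h1 := eta_eq hx
  have h2 := eta_eq hA
  have h3 : 1 / (2 * Real.pi * A) ≤ 1 / (2 * Real.pi * x) := by gcongr
  by_contra! h
  nlinarith [eta_pos hx, eta_pos hA]

lemma eta_le {x A : ℝ} (hA : 0 < A) (hAx : A ≤ x) : eta x ≤ 1 / (2 * Real.pi * A) := by
  have h0 := eta_pos (hA.trans_le hAx)
  have h2 := eta_eq hA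
  have := eta_le_eta hA hAx
  nlinarith [eta_pos hA]

/-- The normalised saddle `v = √x η(x)`, for which `w = v√(T/k)`, solves `v² + v√x = 1/(2π)`. Hence
it decreases in `x` and stays below `1/√(2π)`. -/
lemma sqrt_mul_eta_eq {x : ℝ} (hx : 0 < x) :
    (√x * eta x) ^ 2 + √x * eta x * √x = 1 / (2 * Real.pi) := by
  have h := eta_eq hx
  have hs := Real.sq_sqrt hx.le
  have e : (√x * eta x) ^ 2 + √x * eta x * √x = √x ^ 2 * (eta x * (1 + eta x)) := by ring
  rw [e, hs, h]; field_simp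

lemma sqrt_mul_eta_antitone {x A : ℝ} (hx : 0 < x) (hxA : x ≤ A) :
    √A * eta A ≤ √x * eta x := by
  have hA := hx.trans_le hxA
  have h1 := sqrt_mul_eta_eq hx
  have h2 := sqrt_mul_eta_eq hA
  have p1 : 0 < √x * eta x := mul_pos (Real.sqrt_pos.mpr hx) (eta_pos hx)
  have h3 := Real.sqrt_le_sqrt hxA
  by_contra! h
  nlinarith [Real.sqrt_nonneg x, mul_le_mul h.le h3 (Real.sqrt_nonneg x) (p1.le.trans h.le)]

lemma sqrt_mul_eta_le {x : ℝ} (hx : 0 < x) : √x * eta x ≤ 1 / √(2 * Real.pi) := by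
  have h1 := sqrt_mul_eta_eq hx
  have p1 : 0 < √x * eta x := mul_pos (Real.sqrt_pos.mpr hx) (eta_pos hx)
  refine le_of_pow_le_pow_left₀ two_ne_zero (by positivity) ?_
  rw [div_pow, one_pow, Real.sq_sqrt (by positivity), ← h1]
  have := mul_nonneg p1.le (Real.sqrt_nonneg x)
  linarith

lemma le_sqrt_mul_eta {x A : ℝ} (hx : 0 < x) (hxA : x ≤ A) :
    1 / (2 * Real.pi) / (√A + 1 / √(2 * Real.pi)) ≤ √x * eta x := by
  have h1 := sqrt_mul_eta_eq hx
  have p1 : 0 < √x * eta x := mul_pos (Real.sqrt_pos.mpr hx) (eta_pos hx)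
  have h2 := sqrt_mul_eta_le hx
  have h3 := Real.sqrt_le_sqrt hxA
  rw [div_le_iff₀ (by positivity), ← h1]
  nlinarith

/-- `p = xη(x)` solves `p²/x + p = 1/(2π)`, so it can only grow with `x`. -/
lemma mul_eta_monotone {x A : ℝ} (hA : 0 < A) (hAx : A ≤ x) : A * eta A ≤ x * eta x := by
  have hx := hA.trans_le hAx
  have e : ∀ {z : ℝ}, 0 < z → (z * eta z) ^ 2 / z + z * eta z = 1 / (2 * Real.pi) := by
    intro z hz
    have h := eta_eq hz
    have e : (z * eta z) ^ 2 / z + z * eta z = z * (eta z * (1 + eta z)) := by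
      field_simp; ring
    rw [e, h]; field_simp
  have h1 := e hx
  have h2 := e hA
  have p1 : 0 < x * eta x := mul_pos hx (eta_pos hx)
  by_contra! h
  have h3 : (x * eta x) ^ 2 / x ≤ (A * eta A) ^ 2 / A := by gcongr
  linarith

lemma saddleError_eq (α β γ : ℝ) {k T : ℝ} (hT : 0 < T) :
    saddleError α β γ k T = commonFactor α β γ * (200000 * (eta (k / T) ^ (-α) *
      (1 + eta (k / T)) ^ (γ - β)) *
      (eta (k / T) / (T / (1 + eta (k / T)) * √(T / (1 + eta (k / T)))))) := by
  rw [saddleError, saddle_point_eq_eta hT, commonFactor_eq]; ring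

lemma saddleError_le_small {k T A : ℝ} (hk : 0 < k) (hT : 0 < T) (hA : 0 < A) (hkA : k ≤ A * T) :
    saddleError α β γ k T ≤ commonFactor α β γ * (U42 α β γ A *
      T ^ (1 / 2 * (γ - α - β) - 1 / 4) * k ^ (-(1 / 2) * (γ - α - β) - 5 / 4)) := by
  rw [saddleError_eq α β γ hT]
  refine mul_le_mul_of_nonneg_left ?_ (commonFactor_pos α β γ).le
  set c := γ - α - β with hc
  set x := k / T with hxdef
  have hx : 0 < x := by positivity
  have hxA : x ≤ A := by rw [hxdef, div_le_iff₀ hT]; exact hkA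
  set w := eta x with hwdef
  have hw : 0 < w := eta_pos hx
  set v := √x * w with hvdef
  have hsx : 0 < √x := Real.sqrt_pos.mpr hx
  have hv : 0 < v := mul_pos hsx hw
  have hηA := eta_pos hA
  set B := √A + 1 / √(2 * Real.pi) with hB
  have hB0 : 0 < B := by positivity
  -- Used at the end of `hscale` to replace `B^(1/2)/3` by `B^(3/2)`.
  have hBlow : 1 / 3 ≤ B := by
    have : 1 / 3 ≤ 1 / √(2 * Real.pi) := by
      refine one_div_le_one_div_of_le (by positivity) ?_
      rw [Real.sqrt_le_left (by norm_num)]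
      linarith [Real.pi_lt_four]
    linarith [Real.sqrt_nonneg A]
  set Mx := max ((2 * Real.pi) ^ (-(1 / 2) * c)) ((√A * eta A) ^ c) with hMx
  have hMx0 : 0 ≤ Mx := le_max_of_le_left (by positivity)
  have hweight : w ^ (-α) * (1 + w) ^ (γ - β) ≤
      (T ^ (1 / 2 * c) * k ^ (-(1 / 2) * c)) * Mx * (1 + 1 / eta A) ^ |γ - β| := by
    rw [rpow_mul_one_add_rpow α β γ hw]
    have e1 : w = v * x ^ (-(1 / 2) : ℝ) := by
      rw [hvdef, Real.rpow_neg hx.le, ← Real.sqrt_eq_rpow]; field_simp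
    have e2 : w ^ c = v ^ c * (T ^ (1 / 2 * c) * k ^ (-(1 / 2) * c)) := by
      rw [e1, Real.mul_rpow hv.le (by positivity), ← Real.rpow_mul hx.le, hxdef,
        Real.div_rpow hk.le hT.le, show 1 / 2 * c = -(-(1 / 2) * c) by ring, Real.rpow_neg hT.le]
      ring
    have h1 : v ^ c ≤ Mx := by
      have := rpow_le_max_rpow (e := c) (mul_pos (Real.sqrt_pos.mpr hA) hηA)
        (sqrt_mul_eta_antitone hx hxA) (sqrt_mul_eta_le hx)
      have e3 : (1 / √(2 * Real.pi)) ^ c = (2 * Real.pi) ^ (-(1 / 2) * c) := by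
        rw [one_div, Real.inv_rpow (by positivity), ← Real.rpow_neg (by positivity),
          Real.sqrt_eq_rpow, ← Real.rpow_mul (by positivity)]
        congr 1; ring
      rwa [e3, ← hMx] at this
    have h2 : (1 + 1 / w) ^ (γ - β) ≤ (1 + 1 / eta A) ^ |γ - β| := by
      have : 0 < 1 / w := by positivity
      refine rpow_le_rpow_abs _ (by linarith) ?_
      have := one_div_le_one_div_of_le hηA (eta_le_eta hx hxA)
      linarith
    rw [← hc, e2]
    calc v ^ c * (T ^ (1 / 2 * c) * k ^ (-(1 / 2) * c)) * (1 + 1 / w) ^ (γ - β)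
        ≤ Mx * (T ^ (1 / 2 * c) * k ^ (-(1 / 2) * c)) * (1 + 1 / eta A) ^ |γ - β| := by gcongr
      _ = _ := by ring
  have hscale : w / (T / (1 + w) * √(T / (1 + w))) ≤
      B ^ (3 / 2 : ℝ) * (T ^ (-(1 / 4) : ℝ) * k ^ (-(5 / 4) : ℝ)) := by
    -- So `Λ = 2πkw`, the quotient equals `1/(2πk√Λ)`, and a lower bound for `Λ` is enough.
    have hs : T / (1 + w) = 2 * Real.pi * k * w := by
      have h := eta_eq hx
      rw [div_eq_iff (by positivity)]
      have : 2 * Real.pi * k * w * (1 + w) = 2 * Real.pi * k * (eta x * (1 + eta x)) := by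
        rw [hwdef]; ring
      rw [this, h, hxdef]; field_simp
    have hwB : √(k * T) / B ≤ 2 * Real.pi * k * w := by
      have h := le_sqrt_mul_eta hx hxA
      rw [div_div, div_le_iff₀ (by positivity)] at h
      have e3 : √x * √(k * T) = k := by
        rw [← Real.sqrt_mul hx.le, hxdef, show k / T * (k * T) = k ^ 2 by field_simp,
          Real.sqrt_sq hk.le]
      rw [div_le_iff₀ hB0]
      calc √(k * T) = √(k * T) * 1 := (mul_one _).symm
        _ ≤ √(k * T) * (√x * eta x * (2 * Real.pi * B)) := by gcongr
        _ = (√x * √(k * T)) * (2 * Real.pi * w * B) := by rw [hwdef]; ring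
        _ = _ := by rw [e3]; ring
    have hkT : 0 < k * T := by positivity
    have e4 : √(√(k * T) / B) = k ^ (1 / 4 : ℝ) * T ^ (1 / 4 : ℝ) * B ^ (-(1 / 2) : ℝ) := by
      rw [Real.sqrt_eq_rpow, Real.div_rpow (Real.sqrt_nonneg _) hB0.le, Real.sqrt_eq_rpow,
        ← Real.rpow_mul hkT.le, Real.mul_rpow hk.le hT.le, Real.rpow_neg hB0.le]
      norm_num
      rfl
    have hsqrt : k ^ (1 / 4 : ℝ) * T ^ (1 / 4 : ℝ) * B ^ (-(1 / 2) : ℝ) ≤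
        √(2 * Real.pi * k * w) := by
      rw [← e4]; exact Real.sqrt_le_sqrt hwB
    have hπ : 3 ≤ 2 * Real.pi := by linarith [Real.pi_gt_three]
    have eB : B ^ (3 / 2 : ℝ) = B * B ^ (1 / 2 : ℝ) := by
      rw [← Real.rpow_one_add' hB0.le (by norm_num)]; norm_num
    rw [hs]
    calc w / (2 * Real.pi * k * w * √(2 * Real.pi * k * w))
        ≤ w / (3 * k * w * (k ^ (1 / 4 : ℝ) * T ^ (1 / 4 : ℝ) * B ^ (-(1 / 2) : ℝ))) := by gcongr
      _ = 1 / 3 * (k ^ (1 : ℝ) * k ^ (1 / 4 : ℝ))⁻¹ * (T ^ (1 / 4 : ℝ))⁻¹ *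
          (B ^ (-(1 / 2) : ℝ))⁻¹ := by rw [Real.rpow_one]; field_simp
      _ = 1 / 3 * B ^ (1 / 2 : ℝ) * (T ^ (-(1 / 4) : ℝ) * k ^ (-(5 / 4) : ℝ)) := by
          rw [← Real.rpow_add hk, ← Real.rpow_neg hk.le, ← Real.rpow_neg hT.le,
            ← Real.rpow_neg hB0.le]
          norm_num
          ring
      _ ≤ _ := by
          rw [eB]; gcongr
  have eT : T ^ (1 / 2 * c - 1 / 4) = T ^ (1 / 2 * c) * T ^ (-(1 / 4) : ℝ) := by
    rw [← Real.rpow_add hT, sub_eq_add_neg]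
  have ek : k ^ (-(1 / 2) * c - 5 / 4) = k ^ (-(1 / 2) * c) * k ^ (-(5 / 4) : ℝ) := by
    rw [← Real.rpow_add hk, sub_eq_add_neg]
  rw [U42, eT, ek, ← hB, ← hc, ← hMx]
  calc 200000 * (w ^ (-α) * (1 + w) ^ (γ - β)) * (w / (T / (1 + w) * √(T / (1 + w))))
      ≤ 8.75 * 10 ^ 19 * ((T ^ (1 / 2 * c) * k ^ (-(1 / 2) * c)) * Mx *
          (1 + 1 / eta A) ^ |γ - β|) *
        (B ^ (3 / 2 : ℝ) * (T ^ (-(1 / 4) : ℝ) * k ^ (-(5 / 4) : ℝ))) := by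
        refine mul_le_mul (mul_le_mul (by norm_num) hweight (by positivity) (by norm_num)) hscale
          (by positivity) (by positivity)
    _ = _ := by ring

lemma saddleError_le_large {k T A : ℝ} (hT : 0 < T) (hA : 0 < A) (hα : 0 < α)
    (hkA : A * T ≤ k) :
    saddleError α β γ k T ≤ commonFactor α β γ * (U44 α β γ A *
      T ^ (-(1 / 2) - α) * k ^ (α - 1)) := by
  rw [saddleError_eq α β γ hT]
  refine mul_le_mul_of_nonneg_left ?_ (commonFactor_pos α β γ).le
  have hk : 0 < k := lt_of_lt_of_le (by positivity) hkA
  set x := k / T with hxdef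
  have hx : 0 < x := by positivity
  have hAx : A ≤ x := by rw [hxdef, le_div_iff₀ hT]; exact hkA
  set w := eta x with hwdef
  have hw : 0 < w := eta_pos hx
  have hηA := eta_pos hA
  set B := 1 + 1 / (2 * Real.pi * A) with hB
  have hB0 : 0 < B := by positivity
  have hwB : 1 + w ≤ B := by have := eta_le hA hAx; linarith
  -- Writing `w = (xw)/x` releases the power `x^α`, while `xw` is bounded below by monotonicity.
  have hα1 : w ^ (-α) ≤ (A * eta A) ^ (-α) * x ^ α := by
    have h1 := mul_eta_monotone hA hAx
    have h2 := Real.rpow_le_rpow_of_nonpos (mul_pos hA hηA) h1 (by linarith : -α ≤ 0)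
    have e : w ^ (-α) = (x * w) ^ (-α) * x ^ α := by
      rw [Real.mul_rpow hx.le hw.le, mul_right_comm, ← Real.rpow_add hx, neg_add_cancel,
        Real.rpow_zero, one_mul]
    rw [e]
    gcongr
  have hγβ : (1 + w) ^ (γ - β) ≤ B ^ |γ - β| := rpow_le_rpow_abs _ (by linarith) hwB
  have hscale : w / (T / (1 + w) * √(T / (1 + w))) ≤
      x⁻¹ * B ^ (3 / 2 : ℝ) * T ^ (-(3 / 2) : ℝ) := by
    have h1 : w ≤ x⁻¹ := by
      refine (eta_le hx le_rfl).trans ?_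
      rw [inv_eq_one_div]
      exact one_div_le_one_div_of_le hx (by nlinarith [Real.pi_gt_three])
    have e1 : ∀ z : ℝ, 0 < z → z * √z = z ^ (3 / 2 : ℝ) := fun z hz => by
      rw [Real.sqrt_eq_rpow, ← Real.rpow_one_add' hz.le (by norm_num)]; norm_num
    rw [e1 _ (by positivity), Real.div_rpow hT.le (by positivity), Real.rpow_neg hT.le]
    calc w / (T ^ (3 / 2 : ℝ) / (1 + w) ^ (3 / 2 : ℝ))
        = w * (1 + w) ^ (3 / 2 : ℝ) * (T ^ (3 / 2 : ℝ))⁻¹ := by field_simp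
      _ ≤ _ := by gcongr
  have hx2 : x ^ α * x⁻¹ * T ^ (-(3 / 2) : ℝ) = T ^ (-(1 / 2) - α) * k ^ (α - 1) := by
    rw [← Real.rpow_neg_one x, ← Real.rpow_add hx, hxdef, Real.div_rpow hk.le hT.le,
      div_eq_mul_inv, ← Real.rpow_neg hT.le, mul_assoc, ← Real.rpow_add hT, mul_comm]
    congr 2; ring
  rw [U44, ← hB, Real.rpow_add hB0]
  calc 200000 * (w ^ (-α) * (1 + w) ^ (γ - β)) * (w / (T / (1 + w) * √(T / (1 + w))))
      ≤ 3.5 * 10 ^ 19 * ((A * eta A) ^ (-α) * x ^ α * B ^ |γ - β|) *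
        (x⁻¹ * B ^ (3 / 2 : ℝ) * T ^ (-(3 / 2) : ℝ)) := by
        refine mul_le_mul (mul_le_mul (by norm_num) ?_ (by positivity) (by norm_num)) hscale
          (by positivity) (by positivity)
        exact mul_le_mul hα1 hγβ (by positivity) (by positivity)
    _ = 3.5 * 10 ^ 19 * (A * eta A) ^ (-α) * (B ^ |γ - β| * B ^ (3 / 2 : ℝ)) *
        (x ^ α * x⁻¹ * T ^ (-(3 / 2) : ℝ)) := by ring
    _ = _ := by rw [hx2]; ring

end FirstIntegral

/-! ### The theorem -/

theorem proposition2 (α β γ a b k T T₀ A' A'' : ℝ)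
    (hα : 0 < α) (hα1 : α ≠ 1) (hβ : 0 < β) (hγ : 0 < γ)
    (hA' : 0 < A') (hA'' : 0 < A'')
    (ha : 0 < a) (ha' : a ≤ min 1 (T / (8 * Real.pi * k))) (hb : T ≤ b)
    (hk : 1 ≤ k) (hT₀ : 1 ≤ T₀) (hT : T₀ ≤ T) :
    (∃ E : ℂ,
      ∫ y in a..b, FirstIntegral.integrand α β γ T k y =
          FirstIntegral.mainTerm α β γ k T + E ∧
      (k ≤ A'' * T →
        ‖E‖ ≤ FirstIntegral.commonError α β γ a b k T
          + FirstIntegral.U4small α β γ A'' k T) ∧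
      (A' * T ≤ k →
        ‖E‖ ≤ FirstIntegral.commonError α β γ a b k T
          + FirstIntegral.U4large α β γ A' T₀ k T)) ∧
    (∃ E' : ℂ,
      ∫ y in a..b, FirstIntegral.integrand α β γ T (-k) y = E' ∧
      (k ≤ A'' * T →
        ‖E'‖ ≤ FirstIntegral.commonError α β γ a b k T
          + FirstIntegral.U4hatSmall α β γ A'' k T) ∧
      (A' * T ≤ k →
        ‖E'‖ ≤ FirstIntegral.commonError α β γ a b k T
          + FirstIntegral.U4hatLarge α β γ A' T₀ k T)) := by
  open FirstIntegral in
  have hT1 : 1 ≤ T := hT₀.trans hT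
  have hT0 : 0 < T := by linarith
  have hk0 : 0 < k := by linarith
  have ha1 : a ≤ 1 := ha'.trans (min_le_left _ _)
  have ha2 : a ≤ T / (8 * Real.pi * k) := ha'.trans (min_le_right _ _)
  have hplus := norm_integral_sub_mainTerm_le hα hβ hγ ha ha1 ha2 hk hT0 hb
  have hminus := norm_integral_neg_le hα hβ hγ ha ha1 (ha1.trans (hT1.trans hb)) hk hT0 hb
  have hsmall : k ≤ A'' * T → _ := fun h =>
    boundaryError_le_small (γ := γ) hα hα1 hβ ha ha1 hk hT1 hb hA'' h
  have hlarge := boundaryError_le_large (γ := γ) hα hα1 hβ ha ha1 hk hT₀ hT hb hA'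
  -- `E` is the integral minus the main term, hence the same in both ranges of `k`.
  refine ⟨⟨_, (add_sub_cancel _ _).symm, fun h => ?_, fun h => ?_⟩,
    ⟨_, rfl, fun h => hminus.trans (hsmall h), fun _ => hminus.trans hlarge⟩⟩
  · have e : U4small α β γ A'' k T = U4hatSmall α β γ A'' k T + commonFactor α β γ *
        (U42 α β γ A'' * T ^ (1 / 2 * (γ - α - β) - 1 / 4) *
          k ^ (-(1 / 2) * (γ - α - β) - 5 / 4)) := by
      rw [U4small, U4hatSmall, commonFactor]; ring
    rw [e]
    linarith [hsmall h, saddleError_le_small (α := α) (β := β) (γ := γ) hk0 hT0 hA'' h]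
  · have e : U4large α β γ A' T₀ k T = U4hatLarge α β γ A' T₀ k T + commonFactor α β γ *
        (U44 α β γ A' * T ^ (-(1 / 2) - α) * k ^ (α - 1)) := by
      rw [U4large, U4hatLarge, commonFactor]; ring
    rw [e]
    linarith [saddleError_le_large (β := β) (γ := γ) hT0 hA' hα h]
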